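/- **Theorem (General correspondence theorem).** *Conventions.* All spaces are over $\mathbb K\in\{\mathbb R,\mathbb C\}$. Let $(A,G,\alpha)$ be a Banach algebra dynamical system: $A$ is a (not necessarily unital) Banach algebra, $G$ is a locally compact Hausdorff group, and $\alpha$ is a strongly continuous representation of $G$ on $A$ by bounded algebra automorphisms. Fix a left Haar measure $ds$ on $G$. A covariant representation on a Banach space $X$ is a pair $(\pi,U)$ of an algebra homomorphism $\pi:A\to B(X)$ and a group homomorphism $U$ from $G$ into the invertible elements of $B(X)$ such that $\pi(\alpha_s(a))=U_s\pi(a)U_s^{-1}$ for all $s\in G$, $a\in A$. It is *continuous* if $\pi$ is norm bounded and $U$ is strongly continuous. A representation $T$ of an algebra on $X$ is *non-degenerate* if the linear span of all vectors $T(b)x$ is dense in $X$, and $(\pi,U)$ is non-degenerate if $\pi$ is. For continuous $(\pi,U)$ and $f\in C_c(G,A)$ put $\pi\rtimes U(f)x=\int_G\pi(f(s))U_sx\,ds$. Let $\mathcal R$ be a non-empty uniformly bounded class of continuous covariant representations, i.e. there are $C\ge 0$ and a function $\nu:G\to[0,\infty)$, bounded on compact sets, such that $\|\pi\|\le C$ and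 $\|U_r\|\le\nu(r)$ for all $(\pi,U)\in\mathcal R$ and $r\in G$. Let $\sigma^{\mathcal R}(f)=\sup_{(\pi,U)\in\mathcal R}\|\pi\rtimes U(f)\|$. The crossed product $B:=(A\rtimes_\alpha G)^{\mathcal R}$ is the Banach algebra obtained by completing $C_c(G,A)/\ker\sigma^{\mathcal R}$ in the norm induced by $\sigma^{\mathcal R}$, with the multiplication induced by the twisted convolution $[f*g](s)=\int_G f(r)\alpha_r(g(r^{-1}s))\,dr$; $q:C_c(G,A)\to B$ is the canonical map. A covariant representation $(\pi,U)$ on a Banach space $X$ is *$\mathcal R$-continuous* if it is continuous and $\pi\rtimes U:C_c(G,A)\to B(X)$ is bounded with respect to $\sigma^{\mathcal R}$; then $(\pi\rtimes U)^{\mathcal R}$ is the bounded representation of $B$ on $X$ with $(\pi\rtimes U)^{\mathcal R}(q(f))=\pi\rtimes U(f)$. Let $\mathcal M_l(B)\subset B(B)$ be the algebra of bounded operators $L$ on $B$ with $L(ab)=L(a)b$ for all $a,b\in B$, let $\lambda:B\to\mathcal M_l(B)$ be left multiplication, and let $i_A:A\to\mathcal M_l(B)$ and $i_G:G\to\mathcal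 M_l(B)$ be determined by $i_A(a)q(f)=q\bigl(s\mapsto a f(s)\bigr)$ and $i_G(r)q(f)=q\bigl(s\mapsto\alpha_r(f(r^{-1}s))\bigr)$. *Statement.* Suppose that $A$ has a bounded approximate left identity, that all elements of $\mathcal R$ are non-degenerate, and let $\mathcal X$ be a non-empty class of Banach spaces. Let $\mathrm{Cov}$ be the set of non-degenerate $\mathcal R$-continuous covariant representations of $(A,G,\alpha)$ in spaces from $\mathcal X$, and let $\mathrm{Rep}$ be the set of non-degenerate bounded representations of $B$ in spaces from $\mathcal X$. 1. For every $T\in\mathrm{Rep}$, on $X$ say, there is a unique algebra homomorphism $\overline T:\mathcal M_l(B)\to B(X)$ with $\overline T\circ\lambda=T$; it is unital and bounded. 2. The maps $\mathcal I:(\pi,U)\mapsto(\pi\rtimes U)^{\mathcal R}$ and $\mathcal S:T\mapsto(\overline T\circ i_A,\overline T\circ i_G)$ are bijections $\mathcal I:\mathrm{Cov}\to\mathrm{Rep}$ and $\mathcal S:\mathrm{Rep}\to\mathrm{Cov}$, and they are inverse to each other. 3. Both $\mathcal I$ and $\mathcal S$ preserve the set of closed invariant subspaces of an element of their domain (for a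 covariant representation: closed subspaces invariant under both $\pi$ and $U$), and the space of bounded intertwining operators between two elements of their domain. 4. Suppose that $A$ has a bounded involution, that $\alpha_s(a^*)=\alpha_s(a)^*$ for all $s$ and $a$, and that every $(\pi,U)\in\mathcal R$ is involutive, i.e. its space is a Hilbert space, $\pi$ is a $*$-homomorphism and $U$ is unitary. Let $B$ have the involution induced by $f^*(s)=\Delta(s^{-1})\alpha_s(f(s^{-1})^*)$ on $C_c(G,A)$, where $\Delta$ is the modular function, normalised by $\Delta(r)\int_G f(sr)\,ds=\int_G f(s)\,ds$. Then $\mathcal I$ maps involutive elements of $\mathrm{Cov}$ to involutive elements of $\mathrm{Rep}$, and $\mathcal S$ maps involutive elements of $\mathrm{Rep}$ to involutive elements of $\mathrm{Cov}$. -/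

import Mathlib

open MeasureTheory Filter Topology
open scoped CompactlySupported NNReal

namespace CrossedProd

noncomputable section

universe u v w

/-- A Banach space over `𝕜`. A set of such objects is a class of Banach spaces. -/
structure BanachSp (𝕜 : Type u) [RCLike 𝕜] : Type (max u (w + 1)) where
  carrier : Type w
  [normed : NormedAddCommGroup carrier]
  [space : NormedSpace 𝕜 carrier]
  [complete : CompleteSpace carrier]

instance (𝕜 : Type u) [RCLike 𝕜] : CoeSort (BanachSp.{u, w} 𝕜) (Type w) := ⟨BanachSp.carrier⟩


attribute [instance] BanachSp.normed BanachSp.space BanachSp.complete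

/-- A dynamical system `(A, G, α)`: `act` is a strongly continuous representation of `G` on `A`
by bounded algebra automorphisms (a monoid homomorphism from a group takes values in the
invertible operators). Together with `[CompleteSpace A]` and `G` a locally compact Hausdorff group
this is a Banach algebra dynamical system. -/
structure DynSys (𝕜 : Type*) (A : Type*) (G : Type*) [RCLike 𝕜] [NonUnitalNormedRing A]
    [NormedSpace 𝕜 A] [Group G] [TopologicalSpace G] where
  act : G →* (A →L[𝕜] A)
  act_mul : ∀ (s : G) (a b : A), act s (a * b) = act s a * act s b
  continuous_act : ∀ a : A, Continuous fun s => act s a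

/-- `A` has a bounded approximate left identity: a norm bounded net `u` with `u i * a → a`. -/
def HasBoundedApproxLeftId (A : Type u) [NonUnitalNormedRing A] : Prop :=
  ∃ (ι : Type u) (_ : Preorder ι) (_ : IsDirectedOrder ι) (_ : Nonempty ι) (e : ι → A),
    (∃ M : ℝ, ∀ i, ‖e i‖ ≤ M) ∧ ∀ a : A, Tendsto (fun i => e i * a) atTop (𝓝 a)

/-! ### Representations of algebras -/

section AlgRep

variable {𝕜 B X Y : Type*} [RCLike 𝕜] [NonUnitalNormedRing B] [NormedSpace 𝕜 B]
  [NormedAddCommGroup X] [NormedSpace 𝕜 X] [NormedAddCommGroup Y] [NormedSpace 𝕜 Y]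

/-- The representation `T` is norm bounded. -/
def IsBddRep (T : B →ₙₐ[𝕜] (X →L[𝕜] X)) : Prop := ∃ C : ℝ, ∀ b, ‖T b‖ ≤ C * ‖b‖

/-- The representation `T` is non-degenerate: the span of all `T b x` is dense. -/
def IsNondegRep (T : B →ₙₐ[𝕜] (X →L[𝕜] X)) : Prop :=
  Dense (Submodule.span 𝕜 {y : X | ∃ b x, y = T b x} : Set X)

/-- The subspace `Z` is invariant under the representation `T`. -/
def IsInvariantRep (T : B →ₙₐ[𝕜] (X →L[𝕜] X)) (Z : Submodule 𝕜 X) : Prop :=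
  ∀ b, ∀ z ∈ Z, T b z ∈ Z

/-- The bounded operator `Φ` intertwines `T` and `S`. -/
def IntertwinesRep (T : B →ₙₐ[𝕜] (X →L[𝕜] X)) (S : B →ₙₐ[𝕜] (Y →L[𝕜] Y)) (Φ : X →L[𝕜] Y) : Prop :=
  ∀ b, (S b).comp Φ = Φ.comp (T b)

/-- `X` with its given norm is a Hilbert space with inner product `c`
(this is used for complete spaces `X` only). -/
def IsHilbertCore (c : InnerProductSpace.Core 𝕜 X) : Prop :=
  ∀ x : X, RCLike.re (c.inner x x) = ‖x‖ ^ 2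

/-- With respect to the map `st` as involution on `B`, the representation `T` is involutive:
its space is a Hilbert space, and `T (st b)` is the adjoint of `T b`. -/
def IsInvolutiveRep (st : B → B) (T : B →ₙₐ[𝕜] (X →L[𝕜] X)) : Prop :=
  ∃ c : InnerProductSpace.Core 𝕜 X, IsHilbertCore c ∧
    ∀ b x y, c.inner (T (st b) x) y = c.inner x (T b y)

end AlgRep

/-! ### The vector valued integral -/

section Vint

variable {G H E F : Type*} (𝕜 : Type*) [RCLike 𝕜] [NormedAddCommGroup E] [NormedSpace 𝕜 E]
  [NormedAddCommGroup F] [NormedSpace 𝕜 F] [MeasurableSpace G] [MeasurableSpace H]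

/-- The Bochner integral `∫ f(s) dμ(s)` in a normed space over `𝕜`, considered as a normed space
over `ℝ` by restriction of scalars. -/
def vint (μ : Measure G) (f : G → E) : E :=
  letI : NormedSpace ℝ E := NormedSpace.restrictScalars ℝ 𝕜 E
  ∫ s, f s ∂μ

variable (μ : Measure G) (ν : Measure H) {f g : G → E}

lemma vint_add (hf : Integrable f μ) (hg : Integrable g μ) :
    vint 𝕜 μ (fun s => f s + g s) = vint 𝕜 μ f + vint 𝕜 μ g := by
  let : NormedSpace ℝ E := NormedSpace.restrictScalars ℝ 𝕜 E
  exact integral_add hf hg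

lemma vint_smul (c : 𝕜) : vint 𝕜 μ (fun s => c • f s) = c • vint 𝕜 μ f := by
  let : NormedSpace ℝ E := NormedSpace.restrictScalars ℝ 𝕜 E
  exact integral_smul _ _

lemma norm_vint_le {φ : G → ℝ} (hφ : Integrable φ μ) (h : ∀ s, ‖f s‖ ≤ φ s) :
    ‖vint 𝕜 μ f‖ ≤ ∫ s, φ s ∂μ := by
  let : NormedSpace ℝ E := NormedSpace.restrictScalars ℝ 𝕜 E
  exact norm_integral_le_of_norm_le hφ (Eventually.of_forall h)

lemma vint_eq_zero (h : ∀ s, f s = 0) : vint 𝕜 μ f = 0 := by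
  let : NormedSpace ℝ E := NormedSpace.restrictScalars ℝ 𝕜 E
  exact integral_eq_zero_of_ae (Eventually.of_forall h)

lemma vint_clm [CompleteSpace E] [CompleteSpace F] (L : E →L[𝕜] F) (hf : Integrable f μ) :
    vint 𝕜 μ (fun s => L (f s)) = L (vint 𝕜 μ f) := by
  let : NormedSpace ℝ E := NormedSpace.restrictScalars ℝ 𝕜 E
  let : NormedSpace ℝ F := NormedSpace.restrictScalars ℝ 𝕜 F
  exact L.integral_comp_comm hf

lemma continuous_vint [TopologicalSpace G] [TopologicalSpace H] [OpensMeasurableSpace G]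
    [IsFiniteMeasureOnCompacts μ] {k : Set G} (hk : IsCompact k) {f : H → G → E}
    (hf : Continuous f.uncurry) (hfs : ∀ p x, x ∉ k → f p x = 0) :
    Continuous fun p => vint 𝕜 μ (f p) := by
  let : NormedSpace ℝ E := NormedSpace.restrictScalars ℝ 𝕜 E
  rw [← continuousOn_univ]
  exact continuousOn_integral_of_compact_support hk hf.continuousOn fun p x _ hx => hfs p x hx

lemma vint_swap [TopologicalSpace G] [TopologicalSpace H] [OpensMeasurableSpace G]
    [OpensMeasurableSpace H] [IsFiniteMeasureOnCompacts μ] [IsFiniteMeasureOnCompacts ν]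
    {f : G → H → E} (hf : Continuous f.uncurry) (hfs : HasCompactSupport f.uncurry) :
    vint 𝕜 μ (fun s => vint 𝕜 ν (f s)) = vint 𝕜 ν (fun r => vint 𝕜 μ (fun s => f s r)) := by
  let : NormedSpace ℝ E := NormedSpace.restrictScalars ℝ 𝕜 E
  exact integral_integral_swap_of_hasCompactSupport hf hfs

lemma vint_mul_left [Group G] [MeasurableMul G] [μ.IsMulLeftInvariant] (r : G) :
    vint 𝕜 μ (fun s => f (r * s)) = vint 𝕜 μ f := by
  let : NormedSpace ℝ E := NormedSpace.restrictScalars ℝ 𝕜 E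
  exact integral_mul_left_eq_self f r

end Vint

section System

variable {𝕜 A G : Type*} [RCLike 𝕜] [NonUnitalNormedRing A] [NormedSpace 𝕜 A]
  [Group G] [TopologicalSpace G]

/-! ### Covariant representations -/

/-- A covariant representation `(π, U)` of `(A, G, α)` on `X`. -/
structure CovRep (D : DynSys 𝕜 A G) (X : Type*) [NormedAddCommGroup X] [NormedSpace 𝕜 X] where
  pi : A →ₙₐ[𝕜] (X →L[𝕜] X)
  U : G →* (X →L[𝕜] X)
  covariant : ∀ (s : G) (a : A), pi (D.act s a) = U s * pi a * U s⁻¹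

namespace CovRep

variable {D : DynSys 𝕜 A G} {X Y : Type*} [NormedAddCommGroup X] [NormedSpace 𝕜 X]
  [NormedAddCommGroup Y] [NormedSpace 𝕜 Y]

/-- `π` is norm bounded and `U` is strongly continuous. -/
def IsContinuous (ρ : CovRep D X) : Prop :=
  IsBddRep ρ.pi ∧ ∀ x : X, Continuous fun s => ρ.U s x

/-- `π` is non-degenerate. -/
def IsNondeg (ρ : CovRep D X) : Prop := IsNondegRep ρ.pi

/-- The subspace `Z` is invariant under both `π` and `U`. -/
def IsInvariant (ρ : CovRep D X) (Z : Submodule 𝕜 X) : Prop :=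
  IsInvariantRep ρ.pi Z ∧ ∀ s, ∀ z ∈ Z, ρ.U s z ∈ Z

/-- The bounded operator `Φ` intertwines both components. -/
def Intertwines (ρ : CovRep D X) (τ : CovRep D Y) (Φ : X →L[𝕜] Y) : Prop :=
  IntertwinesRep ρ.pi τ.pi Φ ∧ ∀ s, (τ.U s).comp Φ = Φ.comp (ρ.U s)

/-- `(π, U)` is involutive: for a Hilbert space structure on its space, `π` is involutive and
`U` is unitary. (Each `U s` is invertible, so that unitary means inner product preserving.) -/
def IsInvolutive [Star A] (ρ : CovRep D X) : Prop :=
  ∃ c : InnerProductSpace.Core 𝕜 X, IsHilbertCore c ∧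
    (∀ a x y, c.inner (ρ.pi (star a) x) y = c.inner x (ρ.pi a y)) ∧
    ∀ s x y, c.inner (ρ.U s x) (ρ.U s y) = c.inner x y

/-- The pair `(0, 1)`. -/
def trivial (D : DynSys 𝕜 A G) (X : Type*) [NormedAddCommGroup X] [NormedSpace 𝕜 X] :
    CovRep D X where
  pi := 0
  U := 1
  covariant := by intro s a; simp

end CovRep

/-- A non-empty uniformly bounded class of continuous covariant representations. -/
structure RepClass (D : DynSys 𝕜 A G) where
  carrier : Set (Σ X : BanachSp.{_, v} 𝕜, CovRep D X)
  nonempty : carrier.Nonempty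
  isContinuous : ∀ ρ ∈ carrier, ρ.2.IsContinuous
  uniformlyBounded : ∃ (C : ℝ≥0) (ν : G → ℝ≥0), (∀ K : Set G, IsCompact K → BddAbove (ν '' K)) ∧
    ∀ ρ ∈ carrier, (∀ a, ‖ρ.2.pi a‖ ≤ C * ‖a‖) ∧ ∀ r, ‖ρ.2.U r‖ ≤ ν r

/-! ### Twisted convolution and integrated forms -/

/-- A strongly continuous group representation is bounded on compact sets. -/
lemma exists_bound_of_isCompact {E : Type*} [NormedAddCommGroup E] [NormedSpace 𝕜 E]
    [CompleteSpace E] (V : G →* (E →L[𝕜] E)) (hV : ∀ x, Continuous fun s => V s x)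
    {K : Set G} (hK : IsCompact K) : ∃ M : ℝ, 0 ≤ M ∧ ∀ s ∈ K, ‖V s‖ ≤ M := by
  obtain ⟨M, hM⟩ := banach_steinhaus (g := fun s : K => V s) (fun x => by
    obtain ⟨C, hC⟩ := (hK.image (hV x).norm).bddAbove
    exact ⟨C, fun s => hC ⟨s, s.2, rfl⟩⟩)
  exact ⟨max M 0, le_max_right _ _, fun s hs => (hM ⟨s, hs⟩).trans (le_max_left _ _)⟩

lemma DynSys.continuous_uncurry [LocallyCompactSpace G] [CompleteSpace A] (D : DynSys 𝕜 A G) :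
    Continuous fun p : G × A => D.act p.1 p.2 := by
  rw [continuous_iff_continuousAt]
  rintro ⟨s, a⟩
  obtain ⟨K, hK, hKs⟩ := exists_compact_mem_nhds s
  obtain ⟨M, hM0, hM⟩ := exists_bound_of_isCompact D.act D.continuous_act hK
  have h1 : Tendsto (fun p : G × A => M * ‖p.2 - a‖ + ‖D.act p.1 a - D.act s a‖) (𝓝 (s, a))
      (𝓝 0) := by
    have : Continuous fun p : G × A => M * ‖p.2 - a‖ + ‖D.act p.1 a - D.act s a‖ := by
      have := (D.continuous_act a).comp (continuous_fst (X := G) (Y := A))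
      simp only [Function.comp_def] at this
      fun_prop
    simpa using this.tendsto (s, a)
  rw [ContinuousAt, tendsto_iff_norm_sub_tendsto_zero]
  refine squeeze_zero' (Eventually.of_forall fun _ => norm_nonneg _) ?_ h1
  have : ∀ᶠ p : G × A in 𝓝 (s, a), p.1 ∈ K := continuous_fst.continuousAt hKs
  filter_upwards [this] with p hp
  calc ‖D.act p.1 p.2 - D.act s a‖
      = ‖D.act p.1 (p.2 - a) + (D.act p.1 a - D.act s a)‖ := by rw [map_sub]; congr 1; abel
    _ ≤ ‖D.act p.1 (p.2 - a)‖ + ‖D.act p.1 a - D.act s a‖ := norm_add_le _ _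
    _ ≤ _ := by
      gcongr
      exact (D.act p.1).le_of_opNorm_le (hM _ hp) _

variable [IsTopologicalGroup G] [LocallyCompactSpace G] [CompleteSpace A] [MeasurableSpace G]
  [BorelSpace G]

lemma DynSys.continuous_conv_integrand (D : DynSys 𝕜 A G) (f g : C_c(G, A)) :
    Continuous fun p : G × G => f p.2 * D.act p.2 (g (p.2⁻¹ * p.1)) := by
  have h : Continuous fun p : G × G => D.act p.2 (g (p.2⁻¹ * p.1)) :=
    D.continuous_uncurry.comp (f := fun p : G × G => (p.2, g (p.2⁻¹ * p.1))) (by fun_prop)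
  fun_prop

/-- The twisted convolution `[f * g](s) = ∫ f(r) α_r(g(r⁻¹ s)) dr` on `C_c(G, A)`. -/
def DynSys.conv (D : DynSys 𝕜 A G) (μ : Measure G) [IsFiniteMeasureOnCompacts μ]
    (f g : C_c(G, A)) : C_c(G, A) where
  toFun s := vint 𝕜 μ fun r => f r * D.act r (g (r⁻¹ * s))
  continuous_toFun := continuous_vint 𝕜 μ f.hasCompactSupport
    (D.continuous_conv_integrand f g) fun s r hr => by
      simp [image_eq_zero_of_notMem_tsupport hr]
  hasCompactSupport' := by
    refine HasCompactSupport.of_support_subset_isCompact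
      (K := (fun p : G × G => p.1 * p.2) '' (tsupport f ×ˢ tsupport g))
      ((f.hasCompactSupport.prod g.hasCompactSupport).image continuous_mul) ?_
    intro s hs
    by_contra hn
    refine hs ?_
    refine vint_eq_zero 𝕜 μ fun r => ?_
    by_cases hr : r ∈ tsupport f
    · have : r⁻¹ * s ∉ tsupport g := fun h => hn ⟨(r, r⁻¹ * s), ⟨hr, h⟩, by simp⟩
      simp [image_eq_zero_of_notMem_tsupport this]
    · simp [image_eq_zero_of_notMem_tsupport hr]

namespace CovRep

variable {D : DynSys 𝕜 A G} {X : Type*} [NormedAddCommGroup X] [NormedSpace 𝕜 X]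
  [CompleteSpace X]

/-- `π` as a bounded operator. -/
def piL (ρ : CovRep D X) (h : ρ.IsContinuous) : A →L[𝕜] (X →L[𝕜] X) :=
  LinearMap.mkContinuousOfExistsBound (ρ.pi : A →ₗ[𝕜] (X →L[𝕜] X)) h.1

@[simp] lemma piL_apply (ρ : CovRep D X) (h : ρ.IsContinuous) (a : A) :
    ρ.piL h a = ρ.pi a := rfl

lemma continuous_integrand (ρ : CovRep D X) (h : ρ.IsContinuous) (f : C_c(G, A)) (x : X) :
    Continuous fun s => ρ.pi (f s) (ρ.U s x) :=
  ((ρ.piL h).continuous.comp f.continuous).clm_apply (h.2 x)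

lemma hasCompactSupport_integrand (ρ : CovRep D X) (f : C_c(G, A)) (x : X) :
    HasCompactSupport fun s => ρ.pi (f s) (ρ.U s x) :=
  f.hasCompactSupport.mono fun s hs hf => hs (by simp [hf])

lemma integrable_integrand (ρ : CovRep D X) (h : ρ.IsContinuous) (μ : Measure G)
    [IsFiniteMeasureOnCompacts μ] (f : C_c(G, A)) (x : X) :
    Integrable (fun s => ρ.pi (f s) (ρ.U s x)) μ :=
  (ρ.continuous_integrand h f x).integrable_of_hasCompactSupport
    (ρ.hasCompactSupport_integrand f x)

lemma norm_integral_le (ρ : CovRep D X) (μ : Measure G) [IsFiniteMeasureOnCompacts μ]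
    (f : C_c(G, A)) {C M : ℝ} (hC : ∀ a, ‖ρ.pi a‖ ≤ C * ‖a‖)
    (hM : ∀ s ∈ tsupport f, ‖ρ.U s‖ ≤ M) (x : X) :
    ‖vint 𝕜 μ fun s => ρ.pi (f s) (ρ.U s x)‖ ≤ (C * M * ∫ s, ‖f s‖ ∂μ) * ‖x‖ := by
  have hf : Integrable (fun s => ‖f s‖) μ :=
    (f.continuous.integrable_of_hasCompactSupport f.hasCompactSupport).norm
  have : ∫ s, C * M * ‖x‖ * ‖f s‖ ∂μ = (C * M * ∫ s, ‖f s‖ ∂μ) * ‖x‖ := by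
    rw [integral_const_mul]; ring
  rw [← this]
  refine norm_vint_le 𝕜 μ (hf.const_mul _) fun s => ?_
  by_cases hs : s ∈ tsupport f
  · calc ‖ρ.pi (f s) (ρ.U s x)‖ ≤ (C * ‖f s‖) * (M * ‖x‖) :=
          (ρ.pi (f s)).le_of_opNorm_le_of_le (hC _) ((ρ.U s).le_of_opNorm_le (hM s hs) x)
      _ = _ := by ring
  · simp [image_eq_zero_of_notMem_tsupport hs]

/-- The integrated form `π ⋊ U (f) = ∫ π(f(s)) U_s ds`, the integral being taken pointwise
on `X`. -/
def integrated (ρ : CovRep D X) (h : ρ.IsContinuous) (μ : Measure G)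
    [IsFiniteMeasureOnCompacts μ] : C_c(G, A) →ₗ[𝕜] (X →L[𝕜] X) where
  toFun f := LinearMap.mkContinuousOfExistsBound
    { toFun := fun x => vint 𝕜 μ fun s => ρ.pi (f s) (ρ.U s x)
      map_add' := fun x y => by
        simp only [map_add]
        exact vint_add 𝕜 μ (ρ.integrable_integrand h μ f x) (ρ.integrable_integrand h μ f y)
      map_smul' := fun c x => by
        simp only [map_smul, RingHom.id_apply]
        exact vint_smul 𝕜 μ c }
    (by
      obtain ⟨C, hC⟩ := h.1
      obtain ⟨M, -, hM⟩ := exists_bound_of_isCompact ρ.U h.2 f.hasCompactSupport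
      exact ⟨_, ρ.norm_integral_le μ f hC hM⟩)
  map_add' f g := by
    ext x
    have := vint_add 𝕜 μ (ρ.integrable_integrand h μ f x) (ρ.integrable_integrand h μ g x)
    simpa using this
  map_smul' c f := by
    ext x
    have := vint_smul 𝕜 μ (f := fun s => ρ.pi (f s) (ρ.U s x)) c
    simpa using this

lemma integrated_apply (ρ : CovRep D X) (h : ρ.IsContinuous) (μ : Measure G)
    [IsFiniteMeasureOnCompacts μ] (f : C_c(G, A)) (x : X) :
    ρ.integrated h μ f x = vint 𝕜 μ fun s => ρ.pi (f s) (ρ.U s x) := rfl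

lemma norm_integrated_le (ρ : CovRep D X) (h : ρ.IsContinuous) (μ : Measure G)
    [IsFiniteMeasureOnCompacts μ]
    (f : C_c(G, A)) {C M : ℝ} (hC0 : 0 ≤ C) (hM0 : 0 ≤ M) (hC : ∀ a, ‖ρ.pi a‖ ≤ C * ‖a‖)
    (hM : ∀ s ∈ tsupport f, ‖ρ.U s‖ ≤ M) :
    ‖ρ.integrated h μ f‖ ≤ C * M * ∫ s, ‖f s‖ ∂μ :=
  ContinuousLinearMap.opNorm_le_bound _
    (mul_nonneg (mul_nonneg hC0 hM0) (integral_nonneg fun _ => norm_nonneg _))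
    (ρ.norm_integral_le μ f hC hM)

lemma U_mul_apply (ρ : CovRep D X) (s t : G) (x : X) : ρ.U (s * t) x = ρ.U s (ρ.U t x) := by
  rw [map_mul]; rfl

lemma U_mul_pi (ρ : CovRep D X) (s : G) (a : A) (x : X) :
    ρ.U s (ρ.pi a x) = ρ.pi (D.act s a) (ρ.U s x) := by
  rw [ρ.covariant]
  simp [← U_mul_apply]

/-- The integrated form is multiplicative. -/
lemma integrated_conv (ρ : CovRep D X) (h : ρ.IsContinuous) (μ : Measure G)
    [μ.IsHaarMeasure] (f g : C_c(G, A)) :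
    ρ.integrated h μ (D.conv μ f g) = ρ.integrated h μ f * ρ.integrated h μ g := by
  ext x
  have h1 : ∀ s, ρ.pi (D.conv μ f g s) (ρ.U s x)
      = vint 𝕜 μ fun r => ρ.pi (f r) (ρ.pi (D.act r (g (r⁻¹ * s))) (ρ.U s x)) := by
    intro s
    have hint : Integrable (fun r => f r * D.act r (g (r⁻¹ * s))) μ := by
      refine Continuous.integrable_of_hasCompactSupport
        ((D.continuous_conv_integrand f g).comp (f := fun r => (s, r)) (by fun_prop)) ?_
      exact f.hasCompactSupport.mono fun r hr hf => hr (by simp [hf])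
    have := vint_clm 𝕜 μ ((ContinuousLinearMap.apply 𝕜 X (ρ.U s x)).comp (ρ.piL h)) hint
    simp only [ContinuousLinearMap.comp_apply, piL_apply, ContinuousLinearMap.apply_apply] at this
    change ρ.pi (vint 𝕜 μ fun r => f r * D.act r (g (r⁻¹ * s))) (ρ.U s x) = _
    rw [← this]
    simp
  have hcont : Continuous (Function.uncurry fun s r =>
      ρ.pi (f r) (ρ.pi (D.act r (g (r⁻¹ * s))) (ρ.U s x))) := by
    have h2 : Continuous fun p : G × G =>
        (ρ.piL h) (f p.2 * D.act p.2 (g (p.2⁻¹ * p.1))) :=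
      (ρ.piL h).continuous.comp (D.continuous_conv_integrand f g)
    have h3 := h2.clm_apply ((h.2 x).comp (continuous_fst (X := G) (Y := G)))
    refine h3.congr fun p => ?_
    simp [Function.uncurry]
  have hsupp : HasCompactSupport (Function.uncurry fun s r =>
      ρ.pi (f r) (ρ.pi (D.act r (g (r⁻¹ * s))) (ρ.U s x))) := by
    refine HasCompactSupport.of_support_subset_isCompact
      (K := (fun p : G × G => (p.1 * p.2, p.1)) '' (tsupport f ×ˢ tsupport g))
      ((f.hasCompactSupport.prod g.hasCompactSupport).image (by fun_prop)) ?_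
    rintro ⟨s, r⟩ hs
    by_contra hn
    refine hs ?_
    by_cases hr : r ∈ tsupport f
    · have : r⁻¹ * s ∉ tsupport g := fun h => hn ⟨(r, r⁻¹ * s), ⟨hr, h⟩, by simp⟩
      simp [Function.uncurry, image_eq_zero_of_notMem_tsupport this]
    · simp [Function.uncurry, image_eq_zero_of_notMem_tsupport hr]
  rw [integrated_apply]
  simp only [h1]
  rw [vint_swap 𝕜 μ μ hcont hsupp, mul_apply_eq_comp,
    integrated_apply]
  congr 1
  ext r
  rw [← vint_mul_left 𝕜 μ r]
  simp only [inv_mul_cancel_left, U_mul_apply, ← U_mul_pi]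
  rw [integrated_apply]
  exact vint_clm 𝕜 μ ((ρ.pi (f r)).comp (ρ.U r)) (ρ.integrable_integrand h μ g x)

end CovRep


/-! ### The crossed product -/

namespace RepClass

variable [IsScalarTower 𝕜 A A] [SMulCommClass 𝕜 A A]

variable {D : DynSys 𝕜 A G} (R : RepClass.{v} D) (μ : Measure G) [μ.IsHaarMeasure]

/-- The norm of the integrated form at `f` of an element of the class. -/
def normAt (f : C_c(G, A)) (ρ : R.carrier) : ℝ :=
  ‖ρ.1.2.integrated (R.isContinuous _ ρ.2) μ f‖

lemma bddAbove_normAt (f : C_c(G, A)) : BddAbove (Set.range (R.normAt μ f)) := by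
  obtain ⟨C, ν, hν, h⟩ := R.uniformlyBounded
  obtain ⟨M, hM⟩ := hν _ f.hasCompactSupport
  refine ⟨C * M * ∫ s, ‖f s‖ ∂μ, ?_⟩
  rintro _ ⟨ρ, rfl⟩
  exact ρ.1.2.norm_integrated_le _ μ f C.2 M.2 (h _ ρ.2).1 fun s hs =>
    ((h _ ρ.2).2 s).trans (NNReal.coe_le_coe.2 (hM ⟨s, hs, rfl⟩))

/-- The seminorm `σ(f) = sup ‖π ⋊ U (f)‖` on `C_c(G, A)`, over all `(π, U)` in the class. -/
def sigma : Seminorm 𝕜 C_c(G, A) :=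
  Seminorm.ofSMulLE (fun f => ⨆ ρ : R.carrier, R.normAt μ f ρ)
    (by simp [normAt])
    (fun f g => by
      have := R.nonempty.to_subtype
      refine ciSup_le fun ρ => ?_
      refine (?_ : _ ≤ R.normAt μ f ρ + R.normAt μ g ρ).trans
        (add_le_add (le_ciSup (R.bddAbove_normAt μ f) ρ) (le_ciSup (R.bddAbove_normAt μ g) ρ))
      simp only [normAt, map_add]
      exact norm_add_le _ _)
    (fun c f => by
      have := R.nonempty.to_subtype
      refine ciSup_le fun ρ => ?_
      simp only [normAt, map_smul, norm_smul]
      gcongr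
      exact le_ciSup (R.bddAbove_normAt μ f) ρ)

lemma sigma_apply (f : C_c(G, A)) : R.sigma μ f = ⨆ ρ : R.carrier, R.normAt μ f ρ := rfl

lemma normAt_le_sigma (f : C_c(G, A)) (ρ : R.carrier) : R.normAt μ f ρ ≤ R.sigma μ f :=
  le_ciSup (R.bddAbove_normAt μ f) ρ

lemma sigma_le {f : C_c(G, A)} {C : ℝ} (h : ∀ ρ, R.normAt μ f ρ ≤ C) : R.sigma μ f ≤ C := by
  have := R.nonempty.to_subtype
  exact ciSup_le h

lemma sigma_conv_le (f g : C_c(G, A)) :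
    R.sigma μ (D.conv μ f g) ≤ R.sigma μ f * R.sigma μ g := by
  refine R.sigma_le μ fun ρ => ?_
  refine (?_ : _ ≤ R.normAt μ f ρ * R.normAt μ g ρ).trans
    (mul_le_mul (R.normAt_le_sigma μ f ρ) (R.normAt_le_sigma μ g ρ) (norm_nonneg _)
      (apply_nonneg _ _))
  simp only [normAt, CovRep.integrated_conv]
  exact norm_mul_le _ _

/-- Criterion for equality in the quotient of `C_c(G, A)` by the kernel of `σ`. -/
lemma sigma_eq_zero {f : C_c(G, A)}
    (h : ∀ ρ : R.carrier, ρ.1.2.integrated (R.isContinuous _ ρ.2) μ f = 0) :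
    R.sigma μ f = 0 :=
  le_antisymm (R.sigma_le μ fun ρ => by simp [normAt, h]) (apply_nonneg _ _)

/-- `C_c(G, A)`, to be equipped with the seminorm `σ`. -/
def Pre (_R : RepClass.{v} D) (_μ : Measure G) : Type _ := C_c(G, A)

instance : AddCommGroup (R.Pre μ) := inferInstanceAs (AddCommGroup C_c(G, A))
instance : Module 𝕜 (R.Pre μ) := inferInstanceAs (Module 𝕜 C_c(G, A))
instance : SeminormedAddCommGroup (R.Pre μ) :=
  { AddGroupSeminorm.toSeminormedAddCommGroup (E := R.Pre μ) (R.sigma μ).toAddGroupSeminorm with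
    toAddCommGroup := inferInstance }
instance : NormedSpace 𝕜 (R.Pre μ) where
  norm_smul_le c f := (map_smul_eq_mul (R.sigma μ) c f).le

/-- The identity map from `C_c(G, A)`. -/
def toPre : C_c(G, A) ≃ₗ[𝕜] R.Pre μ := LinearEquiv.refl 𝕜 _

lemma norm_toPre (f : C_c(G, A)) : ‖R.toPre μ f‖ = R.sigma μ f := rfl

/-- The crossed product `(A ⋊ G)^R`: the (Hausdorff) completion of `C_c(G, A)` with respect to
the seminorm `σ`, i.e. the completion of the quotient of `C_c(G, A)` by the kernel of `σ`. -/
abbrev CP : Type _ := UniformSpace.Completion (R.Pre μ)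

/-- The canonical map `q : C_c(G, A) → (A ⋊ G)^R`. -/
def q : C_c(G, A) →ₗ[𝕜] R.CP μ :=
  (UniformSpace.Completion.toComplₗᵢ (𝕜 := 𝕜)).toLinearMap ∘ₗ (R.toPre μ).toLinearMap

lemma norm_q (f : C_c(G, A)) : ‖R.q μ f‖ = R.sigma μ f := by
  change ‖((R.toPre μ f : R.Pre μ) : R.CP μ)‖ = _
  rw [UniformSpace.Completion.norm_coe, norm_toPre]

lemma denseRange_q : DenseRange (R.q μ) :=
  UniformSpace.Completion.denseRange_coe (α := R.Pre μ)

lemma q_eq_of_integrated_eq {f g : C_c(G, A)}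
    (h : ∀ ρ : R.carrier, ρ.1.2.integrated (R.isContinuous _ ρ.2) μ f
      = ρ.1.2.integrated (R.isContinuous _ ρ.2) μ g) : R.q μ f = R.q μ g := by
  rw [← sub_eq_zero, ← map_sub, ← norm_eq_zero, norm_q]
  exact R.sigma_eq_zero μ fun ρ => by rw [map_sub, h, sub_self]

/-- The extension to the crossed product of a `σ`-bounded linear map on `C_c(G, A)`. -/
def extCP {E : Type*} [NormedAddCommGroup E] [NormedSpace 𝕜 E] [CompleteSpace E]
    (T : C_c(G, A) →ₗ[𝕜] E) (hT : ∃ C : ℝ, ∀ f, ‖T f‖ ≤ C * R.sigma μ f) : R.CP μ →L[𝕜] E :=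
  (LinearMap.mkContinuousOfExistsBound (T ∘ₗ (R.toPre μ).symm.toLinearMap) hT).extend
    (UniformSpace.Completion.toComplL (𝕜 := 𝕜))

lemma extCP_q {E : Type*} [NormedAddCommGroup E] [NormedSpace 𝕜 E] [CompleteSpace E]
    (T : C_c(G, A) →ₗ[𝕜] E) (hT : ∃ C : ℝ, ∀ f, ‖T f‖ ≤ C * R.sigma μ f) (f : C_c(G, A)) :
    R.extCP μ T hT (R.q μ f) = T f :=
  ContinuousLinearMap.extend_eq _ UniformSpace.Completion.denseRange_coe
    (UniformSpace.Completion.isUniformInducing_coe _) _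

lemma CP_induction {P : R.CP μ → Prop} (hP : IsClosed {c | P c}) (h : ∀ f, P (R.q μ f))
    (c : R.CP μ) : P c := (R.denseRange_q μ).induction_on c hP h

lemma CP_hom_ext {E : Type*} [NormedAddCommGroup E] [NormedSpace 𝕜 E] {T S : R.CP μ →L[𝕜] E}
    (h : ∀ f, T (R.q μ f) = S (R.q μ f)) : T = S :=
  ContinuousLinearMap.ext fun c =>
    R.CP_induction μ (isClosed_eq T.continuous S.continuous) h c

lemma integrable_conv (f g : C_c(G, A)) (s : G) :
    Integrable (fun r => f r * D.act r (g (r⁻¹ * s))) μ := by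
  refine Continuous.integrable_of_hasCompactSupport
    ((D.continuous_conv_integrand f g).comp (f := fun r => (s, r)) (by fun_prop)) ?_
  exact f.hasCompactSupport.mono fun r hr hf => hr (by simp [hf])

/-- Convolution as a bilinear map. -/
def convₗ (D : DynSys 𝕜 A G) (μ : Measure G) [μ.IsHaarMeasure] :
    C_c(G, A) →ₗ[𝕜] C_c(G, A) →ₗ[𝕜] C_c(G, A) :=
  LinearMap.mk₂ 𝕜 (D.conv μ)
    (fun f f' g => by
      ext s
      refine Eq.trans ?_ (vint_add 𝕜 μ (integrable_conv μ f g s) (integrable_conv μ f' g s))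
      exact congrArg (vint 𝕜 μ) (funext fun r => add_mul _ _ _))
    (fun c f g => by
      ext s
      refine Eq.trans ?_ (vint_smul 𝕜 μ c)
      exact congrArg (vint 𝕜 μ) (funext fun r => smul_mul_assoc _ _ _))
    (fun f g g' => by
      ext s
      refine Eq.trans ?_ (vint_add 𝕜 μ (integrable_conv μ f g s) (integrable_conv μ f g' s))
      exact congrArg (vint 𝕜 μ) (funext fun r => by simp [mul_add]))
    (fun c f g => by
      ext s
      refine Eq.trans ?_ (vint_smul 𝕜 μ c)
      exact congrArg (vint 𝕜 μ) (funext fun r => by simp [mul_smul_comm]))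

lemma convₗ_apply (D : DynSys 𝕜 A G) (μ : Measure G) [μ.IsHaarMeasure] (f g : C_c(G, A)) :
    convₗ D μ f g = D.conv μ f g := rfl

lemma mulL_bound (f g : C_c(G, A)) :
    ‖(R.q μ ∘ₗ convₗ D μ f) g‖ ≤ R.sigma μ f * R.sigma μ g := by
  rw [LinearMap.comp_apply, convₗ_apply, norm_q]
  exact R.sigma_conv_le μ f g

/-- Multiplication of the crossed product as a bilinear map: the extension of convolution. -/
def mulL : R.CP μ →L[𝕜] R.CP μ →L[𝕜] R.CP μ :=
  R.extCP μ
    { toFun := fun f => R.extCP μ (R.q μ ∘ₗ convₗ D μ f) ⟨R.sigma μ f, R.mulL_bound μ f⟩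
      map_add' := fun f g => R.CP_hom_ext μ fun k => by
        rw [_root_.add_apply, extCP_q, extCP_q, extCP_q]
        simp only [LinearMap.comp_apply, map_add, LinearMap.add_apply]
      map_smul' := fun a f => R.CP_hom_ext μ fun k => by
        rw [_root_.smul_apply, extCP_q, extCP_q]
        simp only [LinearMap.comp_apply, map_smul, LinearMap.smul_apply, RingHom.id_apply] }
    ⟨1, fun f => by
      rw [one_mul]
      refine ContinuousLinearMap.opNorm_le_bound _ (apply_nonneg _ _) fun c => ?_
      refine R.CP_induction μ (isClosed_le (ContinuousLinearMap.continuous _).norm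
        (continuous_const.mul continuous_norm)) (fun k => ?_) c
      rw [LinearMap.coe_mk, AddHom.coe_mk, extCP_q]
      change _ ≤ R.sigma μ f * ‖R.q μ k‖
      rw [norm_q]
      exact R.mulL_bound μ f k⟩

lemma mulL_q (f g : C_c(G, A)) : R.mulL μ (R.q μ f) (R.q μ g) = R.q μ (D.conv μ f g) := by
  rw [mulL, extCP_q, LinearMap.coe_mk, AddHom.coe_mk, extCP_q]
  rfl

/-- The crossed product is a Banach algebra. -/
instance : NonUnitalNormedRing (R.CP μ) :=
  { (inferInstance : NormedAddCommGroup (R.CP μ)) with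
    mul := fun a b => R.mulL μ a b
    left_distrib := fun a b c => map_add (R.mulL μ a) b c
    right_distrib := fun a b c => by
      change R.mulL μ (a + b) c = _
      rw [map_add]; rfl
    zero_mul := fun a => by
      change R.mulL μ 0 a = 0
      simp
    mul_zero := fun a => map_zero (R.mulL μ a)
    mul_assoc := fun a b c => by
      change R.mulL μ (R.mulL μ a b) c = R.mulL μ a (R.mulL μ b c)
      have h1 : Continuous fun p : R.CP μ × R.CP μ => R.mulL μ p.1 p.2 :=
        (R.mulL μ).continuous.fst'.clm_apply continuous_snd
      have h2 : ∀ b' c' : R.CP μ, Continuous fun a' => R.mulL μ a' b' := fun b' _ =>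
        h1.comp (f := fun a' => (a', b')) (by fun_prop)
      refine R.CP_induction μ (isClosed_eq ((h2 c c).comp (h2 b b)) (h2 _ c)) (fun f => ?_) a
      refine R.CP_induction μ (isClosed_eq ((h2 c c).comp (R.mulL μ _).continuous)
        ((R.mulL μ _).continuous.comp (h2 c c))) (fun g => ?_) b
      refine R.CP_induction μ (isClosed_eq (R.mulL μ _).continuous
        ((R.mulL μ _).continuous.comp (R.mulL μ _).continuous)) (fun k => ?_) c
      change R.mulL μ (R.mulL μ (R.q μ f) (R.q μ g)) (R.q μ k)
        = R.mulL μ (R.q μ f) (R.mulL μ (R.q μ g) (R.q μ k))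
      simp only [mulL_q]
      exact R.q_eq_of_integrated_eq μ fun ρ => by
        simp only [CovRep.integrated_conv, mul_assoc]
    norm_mul_le := fun a b => by
      change ‖R.mulL μ a b‖ ≤ _
      have h1 : Continuous fun p : R.CP μ × R.CP μ => R.mulL μ p.1 p.2 :=
        (R.mulL μ).continuous.fst'.clm_apply continuous_snd
      refine R.CP_induction μ (isClosed_le
        (h1.comp (f := fun a' => (a', b)) (by fun_prop)).norm
        (continuous_norm.mul continuous_const)) (fun f => ?_) a
      refine R.CP_induction μ (isClosed_le (R.mulL μ _).continuous.norm
        (continuous_const.mul continuous_norm)) (fun g => ?_) b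
      change _ ≤ ‖R.q μ f‖ * ‖R.q μ g‖
      rw [mulL_q]
      simpa only [norm_q] using R.sigma_conv_le μ f g }

lemma mul_def (a b : R.CP μ) : a * b = R.mulL μ a b := rfl

lemma q_mul_q (f g : C_c(G, A)) : R.q μ f * R.q μ g = R.q μ (D.conv μ f g) := R.mulL_q μ f g

instance : IsScalarTower 𝕜 (R.CP μ) (R.CP μ) :=
  ⟨fun c a b => by simp [mul_def]⟩

instance : SMulCommClass 𝕜 (R.CP μ) (R.CP μ) :=
  ⟨fun c a b => by simp [mul_def]⟩

end RepClass

/-! ### Left centralizers -/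

section Centralizer

variable (𝕜 B : Type*) [RCLike 𝕜] [NonUnitalNormedRing B] [NormedSpace 𝕜 B]
  [IsScalarTower 𝕜 B B] [SMulCommClass 𝕜 B B]

/-- The unital normed algebra of left centralizers of `B`. -/
def leftCentralizers : Subalgebra 𝕜 (B →L[𝕜] B) where
  carrier := {L | ∀ a b, L (a * b) = L a * b}
  mul_mem' := fun {L M} hL hM a b => by
    change L (M (a * b)) = L (M a) * b
    rw [hM, hL]
  add_mem' := fun {L M} hL hM a b => by
    change L (a * b) + M (a * b) = (L a + M a) * b
    rw [hL, hM, add_mul]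
  algebraMap_mem' := fun c a b => by
    change c • (a * b) = (c • a) * b
    rw [smul_mul_assoc]

variable {B}

/-- The left centralizer `b' ↦ b * b'`. -/
def leftMul (b : B) : leftCentralizers 𝕜 B :=
  ⟨ContinuousLinearMap.mul 𝕜 B b, fun _ _ => (mul_assoc _ _ _).symm⟩

end Centralizer

/-! ### The canonical maps into the left centralizers of the crossed product -/

variable [IsScalarTower 𝕜 A A] [SMulCommClass 𝕜 A A]

/-- `[i_A(a) f](s) = a f(s)`. -/
def iAfun (𝕜 : Type*) {A G : Type*} [RCLike 𝕜] [NonUnitalNormedRing A] [NormedSpace 𝕜 A]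
    [TopologicalSpace G] [SMulCommClass 𝕜 A A] (a : A) : C_c(G, A) →ₗ[𝕜] C_c(G, A) where
  toFun f :=
    { toFun := fun s => a * f s
      continuous_toFun := by fun_prop
      hasCompactSupport' := f.hasCompactSupport.mono fun s hs hf => hs (by simp [hf]) }
  map_add' f g := by ext s; exact mul_add _ _ _
  map_smul' c f := by ext s; exact mul_smul_comm _ _ _

/-- `[i_G(r) f](s) = α_r(f(r⁻¹ s))`. -/
def iGfun (D : DynSys 𝕜 A G) (r : G) : C_c(G, A) →ₗ[𝕜] C_c(G, A) where
  toFun f :=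
    { toFun := fun s => D.act r (f (r⁻¹ * s))
      continuous_toFun := by fun_prop
      hasCompactSupport' := by
        have := f.hasCompactSupport.comp_homeomorph (Homeomorph.mulLeft r⁻¹)
        exact this.mono fun s hs hf => hs (by
          simp only [Function.comp_apply, Homeomorph.coe_mulLeft] at hf
          simp [hf]) }
  map_add' f g := by ext s; exact map_add (D.act r) _ _
  map_smul' c f := by ext s; exact map_smul (D.act r) _ _

lemma iAfun_apply (a : A) (f : C_c(G, A)) (s : G) : iAfun 𝕜 a f s = a * f s := rfl

lemma iGfun_apply (D : DynSys 𝕜 A G) (r : G) (f : C_c(G, A)) (s : G) :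
    iGfun D r f s = D.act r (f (r⁻¹ * s)) := rfl

namespace CovRep

variable {D : DynSys 𝕜 A G} {X : Type*} [NormedAddCommGroup X] [NormedSpace 𝕜 X]
  [CompleteSpace X]

lemma integrated_iAfun (ρ : CovRep D X) (h : ρ.IsContinuous) (μ : Measure G) [μ.IsHaarMeasure]
    (a : A) (f : C_c(G, A)) :
    ρ.integrated h μ (iAfun 𝕜 a f) = ρ.pi a * ρ.integrated h μ f := by
  ext x
  rw [integrated_apply, mul_apply_eq_comp, integrated_apply,
    ← vint_clm 𝕜 μ _ (ρ.integrable_integrand h μ f x)]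
  simp [iAfun_apply]

lemma integrated_iGfun (ρ : CovRep D X) (h : ρ.IsContinuous) (μ : Measure G) [μ.IsHaarMeasure]
    (r : G) (f : C_c(G, A)) :
    ρ.integrated h μ (iGfun D r f) = ρ.U r * ρ.integrated h μ f := by
  ext x
  rw [integrated_apply, mul_apply_eq_comp, integrated_apply,
    ← vint_clm 𝕜 μ _ (ρ.integrable_integrand h μ f x), ← vint_mul_left 𝕜 μ r]
  simp [iGfun_apply, U_mul_pi]

end CovRep

namespace RepClass

variable {D : DynSys 𝕜 A G} (R : RepClass.{v} D) (μ : Measure G) [μ.IsHaarMeasure]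

lemma sigma_iAfun_le (a : A) : ∃ C : ℝ, ∀ f, R.sigma μ (iAfun 𝕜 a f) ≤ C * R.sigma μ f := by
  obtain ⟨C, ν, -, h⟩ := R.uniformlyBounded
  refine ⟨C * ‖a‖, fun f => R.sigma_le μ fun ρ => ?_⟩
  rw [normAt, CovRep.integrated_iAfun]
  exact (norm_mul_le _ _).trans (mul_le_mul ((h _ ρ.2).1 a) (R.normAt_le_sigma μ f ρ)
    (norm_nonneg _) (by positivity))

lemma sigma_iGfun_le (r : G) : ∃ C : ℝ, ∀ f, R.sigma μ (iGfun D r f) ≤ C * R.sigma μ f := by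
  obtain ⟨C, ν, -, h⟩ := R.uniformlyBounded
  refine ⟨ν r, fun f => R.sigma_le μ fun ρ => ?_⟩
  rw [normAt, CovRep.integrated_iGfun]
  exact (norm_mul_le _ _).trans (mul_le_mul ((h _ ρ.2).2 r) (R.normAt_le_sigma μ f ρ)
    (norm_nonneg _) (by positivity))

/-- The bounded operator on the crossed product induced by a `σ`-bounded operator on
`C_c(G, A)`. -/
def lift (S : C_c(G, A) →ₗ[𝕜] C_c(G, A)) (hS : ∃ C : ℝ, ∀ f, R.sigma μ (S f) ≤ C * R.sigma μ f) :
    R.CP μ →L[𝕜] R.CP μ :=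
  R.extCP μ (R.q μ ∘ₗ S) (by simpa only [LinearMap.comp_apply, norm_q] using hS)

lemma lift_q (S : C_c(G, A) →ₗ[𝕜] C_c(G, A))
    (hS : ∃ C : ℝ, ∀ f, R.sigma μ (S f) ≤ C * R.sigma μ f) (f : C_c(G, A)) :
    R.lift μ S hS (R.q μ f) = R.q μ (S f) := R.extCP_q μ _ _ f

lemma mem_leftCentralizers {L : R.CP μ →L[𝕜] R.CP μ}
    (h : ∀ f g, L (R.q μ f * R.q μ g) = L (R.q μ f) * R.q μ g) :
    L ∈ leftCentralizers 𝕜 (R.CP μ) := by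
  intro a b
  refine R.CP_induction μ (P := fun a => L (a * b) = L a * b)
    (isClosed_eq (by fun_prop) (by fun_prop)) (fun f => ?_) a
  refine R.CP_induction μ (P := fun b => L (R.q μ f * b) = L (R.q μ f) * b)
    (isClosed_eq (by fun_prop) (by fun_prop)) (fun g => h f g) b

/-- The operator `i_A(a)` on the crossed product, determined by `i_A(a) (q f) = q (i_A(a) f)`. -/
def iAelt (a : A) : leftCentralizers 𝕜 (R.CP μ) :=
  ⟨R.lift μ (iAfun 𝕜 a) (R.sigma_iAfun_le μ a), R.mem_leftCentralizers μ fun f g => by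
    rw [q_mul_q, lift_q, lift_q, q_mul_q]
    exact R.q_eq_of_integrated_eq μ fun ρ => by
      simp only [CovRep.integrated_conv, CovRep.integrated_iAfun, mul_assoc]⟩

/-- The operator `i_G(r)` on the crossed product, determined by `i_G(r) (q f) = q (i_G(r) f)`. -/
def iGelt (r : G) : leftCentralizers 𝕜 (R.CP μ) :=
  ⟨R.lift μ (iGfun D r) (R.sigma_iGfun_le μ r), R.mem_leftCentralizers μ fun f g => by
    rw [q_mul_q, lift_q, lift_q, q_mul_q]
    exact R.q_eq_of_integrated_eq μ fun ρ => by
      simp only [CovRep.integrated_conv, CovRep.integrated_iGfun, mul_assoc]⟩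

lemma iAelt_q (a : A) (f : C_c(G, A)) : (R.iAelt μ a).1 (R.q μ f) = R.q μ (iAfun 𝕜 a f) :=
  R.lift_q μ _ (R.sigma_iAfun_le μ a) f

lemma iGelt_q (r : G) (f : C_c(G, A)) : (R.iGelt μ r).1 (R.q μ f) = R.q μ (iGfun D r f) :=
  R.lift_q μ _ (R.sigma_iGfun_le μ r) f

/-- The representation `a ↦ i_A(a)` of `A` on the crossed product, with values in the left
centralizers. -/
def iA : A →ₙₐ[𝕜] leftCentralizers 𝕜 (R.CP μ) where
  toFun := R.iAelt μ
  map_smul' c a := Subtype.ext (R.CP_hom_ext μ fun f => by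
    change (R.iAelt μ (c • a)).1 _ = c • (R.iAelt μ a).1 _
    rw [iAelt_q, iAelt_q, ← map_smul]
    exact congrArg _ (by ext s; exact smul_mul_assoc _ _ _))
  map_zero' := Subtype.ext (R.CP_hom_ext μ fun f => by
    change (R.iAelt μ 0).1 _ = 0
    rw [iAelt_q, ← map_zero (R.q μ)]
    exact congrArg _ (by ext s; exact zero_mul _))
  map_add' a b := Subtype.ext (R.CP_hom_ext μ fun f => by
    change (R.iAelt μ (a + b)).1 _ = (R.iAelt μ a).1 _ + (R.iAelt μ b).1 _
    rw [iAelt_q, iAelt_q, iAelt_q, ← map_add]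
    exact congrArg _ (by ext s; exact add_mul _ _ _))
  map_mul' a b := Subtype.ext (R.CP_hom_ext μ fun f => by
    change (R.iAelt μ (a * b)).1 _ = (R.iAelt μ a).1 ((R.iAelt μ b).1 _)
    rw [iAelt_q, iAelt_q, iAelt_q]
    exact congrArg _ (by ext s; exact mul_assoc _ _ _))

/-- The representation `r ↦ i_G(r)` of `G` on the crossed product, with values in the left
centralizers. -/
def iG : G →* leftCentralizers 𝕜 (R.CP μ) where
  toFun := R.iGelt μ
  map_one' := Subtype.ext (R.CP_hom_ext μ fun f => by
    change (R.iGelt μ 1).1 _ = R.q μ f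
    rw [iGelt_q]
    exact congrArg _ (by ext s; simp [iGfun_apply]))
  map_mul' r t := Subtype.ext (R.CP_hom_ext μ fun f => by
    change (R.iGelt μ (r * t)).1 _ = (R.iGelt μ r).1 ((R.iGelt μ t).1 _)
    rw [iGelt_q, iGelt_q, iGelt_q]
    exact congrArg _ (by ext s; simp [iGfun_apply, mul_assoc]))

lemma iA_q (a : A) (f : C_c(G, A)) : (R.iA μ a).1 (R.q μ f) = R.q μ (iAfun 𝕜 a f) :=
  R.iAelt_q μ a f

lemma iG_q (r : G) (f : C_c(G, A)) : (R.iG μ r).1 (R.q μ f) = R.q μ (iGfun D r f) :=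
  R.iGelt_q μ r f

lemma iA_act (s : G) (a : A) : R.iA μ (D.act s a) = R.iG μ s * R.iA μ a * R.iG μ s⁻¹ :=
  Subtype.ext (R.CP_hom_ext μ fun f => by
    change (R.iA μ (D.act s a)).1 _ = (R.iG μ s).1 ((R.iA μ a).1 ((R.iG μ s⁻¹).1 _))
    rw [iA_q, iG_q, iA_q, iG_q]
    refine congrArg _ ?_
    ext t
    simp only [iGfun_apply, iAfun_apply, D.act_mul]
    congr 1
    have : D.act s (D.act s⁻¹ (f t)) = f t := by
      change (D.act s * D.act s⁻¹) (f t) = f t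
      rw [← map_mul]; simp
    simp [this])

/-- The covariant representation `(T̄ ∘ i_A, T̄ ∘ i_G)`, for a unital homomorphism `T̄` on the
left centralizers of the crossed product. -/
def ofCentralizers {X : Type*} [NormedAddCommGroup X] [NormedSpace 𝕜 X]
    (Tbar : leftCentralizers 𝕜 (R.CP μ) →ₐ[𝕜] (X →L[𝕜] X)) : CovRep D X where
  pi := (Tbar : leftCentralizers 𝕜 (R.CP μ) →ₙₐ[𝕜] (X →L[𝕜] X)).comp (R.iA μ)
  U := (Tbar : leftCentralizers 𝕜 (R.CP μ) →* (X →L[𝕜] X)).comp (R.iG μ)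
  covariant s a := by
    change Tbar (R.iA μ (D.act s a)) = Tbar (R.iG μ s) * Tbar (R.iA μ a) * Tbar (R.iG μ s⁻¹)
    rw [iA_act, map_mul, map_mul]

/-! ### Integration and separation -/

/-- `(π, U)` is continuous and `π ⋊ U` is bounded with respect to `σ`. -/
def IsRContinuous {X : Type*} [NormedAddCommGroup X] [NormedSpace 𝕜 X] [CompleteSpace X]
    (ρ : CovRep D X) : Prop :=
  ∃ h : ρ.IsContinuous, ∃ C : ℝ, ∀ f, ‖ρ.integrated h μ f‖ ≤ C * R.sigma μ f

/-- The representation `(π ⋊ U)^R` of the crossed product, determined by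
`(π ⋊ U)^R (q f) = π ⋊ U (f)`. -/
def integratedRep {X : Type*} [NormedAddCommGroup X] [NormedSpace 𝕜 X] [CompleteSpace X]
    (ρ : CovRep D X) (h : R.IsRContinuous μ ρ) : R.CP μ →ₙₐ[𝕜] (X →L[𝕜] X) where
  toFun := R.extCP μ (ρ.integrated h.1 μ) h.2
  map_smul' := map_smul _
  map_zero' := map_zero _
  map_add' := map_add _
  map_mul' a b := by
    refine R.CP_induction μ (P := fun a => R.extCP μ (ρ.integrated h.1 μ) h.2 (a * b) =
      R.extCP μ (ρ.integrated h.1 μ) h.2 a * R.extCP μ (ρ.integrated h.1 μ) h.2 b)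
      (isClosed_eq (by fun_prop) (by fun_prop)) (fun f => ?_) a
    refine R.CP_induction μ (P := fun b => R.extCP μ (ρ.integrated h.1 μ) h.2 (R.q μ f * b) =
      R.extCP μ (ρ.integrated h.1 μ) h.2 (R.q μ f) * R.extCP μ (ρ.integrated h.1 μ) h.2 b)
      (isClosed_eq (by fun_prop) (by fun_prop)) (fun g => ?_) b
    rw [q_mul_q, extCP_q, extCP_q, extCP_q, CovRep.integrated_conv]

lemma integratedRep_q {X : Type*} [NormedAddCommGroup X] [NormedSpace 𝕜 X] [CompleteSpace X]
    (ρ : CovRep D X) (h : R.IsRContinuous μ ρ) (f : C_c(G, A)) :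
    R.integratedRep μ ρ h (R.q μ f) = ρ.integrated h.1 μ f := R.extCP_q μ _ _ f

/-- The homomorphism `T̄` on the left centralizers of the crossed product extends the
representation `T` of the crossed product, i.e. `T̄ (leftMul c) = T c` for all `c`. -/
def Extends {X : Type*} [NormedAddCommGroup X] [NormedSpace 𝕜 X]
    (Tbar : leftCentralizers 𝕜 (R.CP μ) →ₙₐ[𝕜] (X →L[𝕜] X)) (T : R.CP μ →ₙₐ[𝕜] (X →L[𝕜] X)) :
    Prop :=
  ∀ c, Tbar (leftMul 𝕜 c) = T c

open scoped Classical in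
/-- Integration: `(π, U) ↦ (π ⋊ U)^R` for `R`-continuous `(π, U)`. (On other covariant
representations, where the map is not defined, it takes the value `0`.) -/
def integration (ρ : Σ X : BanachSp.{_, w} 𝕜, CovRep D X) :
    Σ X : BanachSp.{_, w} 𝕜, (R.CP μ →ₙₐ[𝕜] (X →L[𝕜] X)) :=
  ⟨ρ.1, if h : R.IsRContinuous μ ρ.2 then R.integratedRep μ ρ.2 h else 0⟩

open scoped Classical in
/-- The covariant representation `(T̄ ∘ i_A, T̄ ∘ i_G)`, where `T̄` is a unital homomorphism on the
left centralizers of the crossed product that extends `T`. (If there is no such `T̄`, it is the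
pair `(0, 1)`.) -/
def separatedRep {X : Type*} [NormedAddCommGroup X] [NormedSpace 𝕜 X]
    (T : R.CP μ →ₙₐ[𝕜] (X →L[𝕜] X)) : CovRep D X :=
  if h : ∃ Tbar : leftCentralizers 𝕜 (R.CP μ) →ₐ[𝕜] (X →L[𝕜] X),
    R.Extends μ (Tbar : leftCentralizers 𝕜 (R.CP μ) →ₙₐ[𝕜] (X →L[𝕜] X)) T
    then R.ofCentralizers μ h.choose else CovRep.trivial D X

/-- Separation: `T ↦ (T̄ ∘ i_A, T̄ ∘ i_G)`. -/
def separation (T : Σ X : BanachSp.{_, w} 𝕜, (R.CP μ →ₙₐ[𝕜] (X →L[𝕜] X))) :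
    Σ X : BanachSp.{_, w} 𝕜, CovRep D X :=
  ⟨T.1, R.separatedRep μ T.2⟩

/-- The non-degenerate `R`-continuous covariant representations in spaces from `𝓧`. -/
def covRepSet (𝓧 : Set (BanachSp.{_, w} 𝕜)) : Set (Σ X : BanachSp.{_, w} 𝕜, CovRep D X) :=
  {ρ | ρ.1 ∈ 𝓧 ∧ ρ.2.IsNondeg ∧ R.IsRContinuous μ ρ.2}

/-- The non-degenerate bounded representations of the crossed product in spaces from `𝓧`. -/
def repSet (𝓧 : Set (BanachSp.{_, w} 𝕜)) :
    Set (Σ X : BanachSp.{_, w} 𝕜, (R.CP μ →ₙₐ[𝕜] (X →L[𝕜] X))) :=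
  {T | T.1 ∈ 𝓧 ∧ IsNondegRep T.2 ∧ IsBddRep T.2}

end RepClass

end System

/-! ### The involutive case -/

section Modular

variable {G : Type*} [Group G] [TopologicalSpace G] [IsTopologicalGroup G]
  [LocallyCompactSpace G]

/-- The modular function `Δ` of `G`, normalised by `Δ(r) ∫ f(s r) ds = ∫ f(s) ds`; it is the
inverse of the modular character of Mathlib. -/
def modular (r : G) : ℝ := ((Measure.modularCharacter r : ℝ≥0) : ℝ)⁻¹

lemma modular_pos (r : G) : 0 < modular r :=
  inv_pos.2 (Measure.modularCharacterFun_pos r)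

lemma modular_inv (r : G) : modular r⁻¹ = (modular r)⁻¹ := by simp [modular]

lemma modular_mul_integral [MeasurableSpace G] [BorelSpace G] (μ : Measure G)
    [μ.IsHaarMeasure] (r : G) {f : G → ℝ} (hf : Continuous f) (h'f : HasCompactSupport f) :
    modular r * ∫ s, f (s * r) ∂μ = ∫ s, f s ∂μ := by
  have h1 : ∫ s, f (s * r) ∂μ = ∫ s, f s ∂(μ.map (· * r)) := by
    rw [integral_map (by fun_prop) hf.aestronglyMeasurable]
  have h2 : ∫ s, f s ∂(μ.map (· * r)) = Measure.modularCharacter r • ∫ s, f s ∂μ := by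
    rw [Measure.integral_isMulLeftInvariant_eq_smul_of_hasCompactSupport (μ.map (· * r)) μ hf h'f,
      integral_smul_nnreal_measure]
    congr 1
    exact (Measure.modularCharacterFun_eq_haarScalarFactor μ r).symm
  have h3 : ((Measure.modularCharacter r : ℝ≥0) : ℝ) ≠ 0 :=
    (NNReal.coe_pos.2 (Measure.modularCharacterFun_pos r)).ne'
  rw [h1, h2, modular, NNReal.smul_def, smul_eq_mul, inv_mul_cancel_left₀ h3]

lemma continuous_modular : Continuous (modular : G → ℝ) := by
  borelize G
  let μ : Measure G := Measure.haar
  obtain ⟨⟨f, hf⟩, h'f, hf0, hf1⟩ :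
    ∃ f : C(G, ℝ), HasCompactSupport f ∧ 0 ≤ f ∧ f 1 ≠ 0 := exists_continuous_nonneg_pos 1
  simp only [ContinuousMap.coe_mk] at h'f hf1
  have hpos : 0 < ∫ s, f s ∂μ := hf.integral_pos_of_hasCompactSupport_nonneg_nonzero h'f hf0 hf1
  have hI : Continuous fun r : G => ∫ s, f (s * r) ∂μ := by
    rw [continuous_iff_continuousAt]
    intro r
    obtain ⟨K, hK, hKr⟩ := exists_compact_mem_nhds r
    have : ContinuousOn (fun r : G => ∫ s, f (s * r) ∂μ) K := by
      refine continuousOn_integral_of_compact_support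
        (k := (fun p : G × G => p.1 * p.2⁻¹) '' (tsupport f ×ˢ K))
        ((h'f.isCompact.prod hK).image (by fun_prop)) (Continuous.continuousOn (by
          simp only [Function.uncurry_def]; fun_prop)) ?_
      intro p s hp hs
      refine image_eq_zero_of_notMem_tsupport fun h => hs ?_
      exact ⟨(s * p, p), ⟨h, hp⟩, by simp⟩
    exact this.continuousAt hKr
  have h0 : ∀ r : G, ∫ s, f (s * r) ∂μ ≠ 0 := by
    intro r h
    have := modular_mul_integral μ r hf h'f
    rw [h, mul_zero] at this
    exact hpos.ne this
  have : (modular : G → ℝ) = fun r => (∫ s, f s ∂μ) / ∫ s, f (s * r) ∂μ := by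
    ext r
    rw [eq_div_iff (h0 r)]
    exact modular_mul_integral μ r hf h'f
  rw [this]
  exact continuous_const.div hI h0

lemma integral_modular_inv [MeasurableSpace G] [BorelSpace G] (μ : Measure G)
    [μ.IsHaarMeasure] {f : G → ℝ} (hf : Continuous f) (h'f : HasCompactSupport f) :
    ∫ s, modular s⁻¹ * f s⁻¹ ∂μ = ∫ s, f s ∂μ := by
  obtain ⟨⟨g, hg⟩, h'g, hg0, hg1⟩ :
    ∃ f : C(G, ℝ), HasCompactSupport f ∧ 0 ≤ f ∧ f 1 ≠ 0 := exists_continuous_nonneg_pos 1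
  simp only [ContinuousMap.coe_mk] at h'g hg1
  have hpos : 0 < ∫ s, g s ∂μ := hg.integral_pos_of_hasCompactSupport_nonneg_nonzero h'g hg0 hg1
  have hinv : ∀ φ : G → ℝ, ∫ s, φ s ∂μ.inv = ∫ s, φ s⁻¹ ∂μ := fun φ =>
    integral_map_equiv (MeasurableEquiv.inv G) φ
  rw [Measure.integral_isMulLeftInvariant_isMulRightInvariant_combo (μ := μ) (ν := μ.inv)
    hf h'f hg h'g hg0 hg1, hinv, ← integral_mul_const]
  congr 1
  ext s
  rw [hinv]
  simp only [inv_inv]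
  have := modular_mul_integral μ s⁻¹ hg h'g
  have h2 := modular_pos s⁻¹
  have h3 : ∫ t, g (t * s⁻¹) ∂μ ≠ 0 := by
    intro h
    rw [h, mul_zero] at this
    exact hpos.ne this
  rw [← this]
  field_simp

lemma vint_modular_inv [MeasurableSpace G] [BorelSpace G] (μ : Measure G)
    [μ.IsHaarMeasure] {E : Type*} (𝕜 : Type*) [RCLike 𝕜] [NormedAddCommGroup E]
    [NormedSpace 𝕜 E] [CompleteSpace E] {f : G → E} (hf : Continuous f)
    (h'f : HasCompactSupport f) :
    vint 𝕜 μ (fun s => (modular s⁻¹ : 𝕜) • f s⁻¹) = vint 𝕜 μ f := by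
  let : NormedSpace ℝ E := NormedSpace.restrictScalars ℝ 𝕜 E
  have hs : ∀ s, (modular s⁻¹ : 𝕜) • f s⁻¹ = modular s⁻¹ • f s⁻¹ := by
    intro s
    change _ = (algebraMap ℝ 𝕜 (modular s⁻¹)) • f s⁻¹
    rfl
  change ∫ s, (modular s⁻¹ : 𝕜) • f s⁻¹ ∂μ = ∫ s, f s ∂μ
  simp only [hs]
  have hc : HasCompactSupport fun s => modular s⁻¹ • f s⁻¹ :=
    (h'f.comp_homeomorph (Homeomorph.inv G)).smul_left
  have hc' : Continuous fun s => modular s⁻¹ • f s⁻¹ := by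
    have := continuous_modular (G := G)
    fun_prop
  refine (SeparatingDual.eq_iff_forall_dual_eq (R := ℝ)).2 fun ℓ => ?_
  rw [← ℓ.integral_comp_comm (hc'.integrable_of_hasCompactSupport hc),
    ← ℓ.integral_comp_comm (hf.integrable_of_hasCompactSupport h'f)]
  simp only [map_smul, smul_eq_mul]
  exact integral_modular_inv μ (ℓ.continuous.comp hf) (h'f.comp_left (map_zero ℓ))

end Modular

lemma vint_conj {G 𝕜 : Type*} [RCLike 𝕜] [MeasurableSpace G] (μ : Measure G) {f : G → 𝕜}
    (hf : Integrable f μ) :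
    vint 𝕜 μ (fun s => starRingEnd 𝕜 (f s)) = starRingEnd 𝕜 (vint 𝕜 μ f) := by
  let : NormedSpace ℝ 𝕜 := NormedSpace.restrictScalars ℝ 𝕜 𝕜
  let L : 𝕜 →L[ℝ] 𝕜 :=
    { toFun := starRingEnd 𝕜
      map_add' := map_add _
      map_smul' := fun r z => by
        change starRingEnd 𝕜 ((r : 𝕜) * z) = (r : 𝕜) * starRingEnd 𝕜 z
        rw [map_mul, RCLike.conj_ofReal]
      cont := RCLike.continuous_conj }
  exact L.integral_comp_comm hf

section Involutive

variable {𝕜 A G : Type*} [RCLike 𝕜] [NonUnitalNormedRing A] [NormedSpace 𝕜 A]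
  [StarRing A] [StarModule 𝕜 A] [Group G] [TopologicalSpace G]

/-- The system is involutive: the involution of `A` is bounded, and all `α_s` are involutive. -/
structure DynSys.IsInvolutive (D : DynSys 𝕜 A G) : Prop where
  bounded : ∃ C : ℝ, ∀ a : A, ‖star a‖ ≤ C * ‖a‖
  act_star : ∀ (s : G) (a : A), D.act s (star a) = star (D.act s a)

lemma DynSys.IsInvolutive.continuous_star {D : DynSys 𝕜 A G} (hD : D.IsInvolutive) :
    Continuous (star : A → A) := by
  obtain ⟨C, hC⟩ := hD.bounded
  exact AddMonoidHomClass.continuous_of_bound (starAddEquiv (R := A)) C hC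

variable [IsTopologicalGroup G] [LocallyCompactSpace G] [CompleteSpace A]

/-- The involution `f^*(s) = Δ(s⁻¹) α_s(f(s⁻¹)^*)` of `C_c(G, A)`. -/
def DynSys.invol (D : DynSys 𝕜 A G) (hD : D.IsInvolutive) (f : C_c(G, A)) : C_c(G, A) where
  toFun s := (modular s⁻¹ : 𝕜) • D.act s (star (f s⁻¹))
  continuous_toFun := by
    have h1 : Continuous fun s => D.act s (star (f s⁻¹)) :=
      D.continuous_uncurry.comp (f := fun s => (s, star (f s⁻¹)))
        (continuous_id.prodMk (hD.continuous_star.comp (by fun_prop)))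
    have h2 : Continuous fun s : G => (modular s⁻¹ : 𝕜) :=
      RCLike.continuous_ofReal.comp (continuous_modular.comp continuous_inv)
    exact h2.smul h1
  hasCompactSupport' := by
    refine (f.hasCompactSupport.comp_homeomorph (Homeomorph.inv G)).mono fun s hs hf => hs ?_
    simp only [Function.comp_apply, Homeomorph.coe_inv] at hf
    simp [hf]

lemma DynSys.invol_apply (D : DynSys 𝕜 A G) (hD : D.IsInvolutive) (f : C_c(G, A)) (s : G) :
    D.invol hD f s = (modular s⁻¹ : 𝕜) • D.act s (star (f s⁻¹)) := rfl

lemma DynSys.invol_sub (D : DynSys 𝕜 A G) (hD : D.IsInvolutive) (f g : C_c(G, A)) :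
    D.invol hD (f - g) = D.invol hD f - D.invol hD g := by
  ext s
  simp [DynSys.invol_apply, smul_sub]

variable [MeasurableSpace G] [BorelSpace G]

/-- The integrated form of an involutive covariant representation is involutive. -/
lemma CovRep.inner_integrated_invol {D : DynSys 𝕜 A G} (hD : D.IsInvolutive)
    {X : Type*} [NormedAddCommGroup X]
    [NormedSpace 𝕜 X] [CompleteSpace X] (ρ : CovRep D X) (h : ρ.IsContinuous) (μ : Measure G)
    [μ.IsHaarMeasure] (c : InnerProductSpace.Core 𝕜 X) (hc : IsHilbertCore c)
    (hpi : ∀ a x y, c.inner (ρ.pi (star a) x) y = c.inner x (ρ.pi a y))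
    (hU : ∀ s x y, c.inner (ρ.U s x) (ρ.U s y) = c.inner x y) (f : C_c(G, A)) (x y : X) :
    c.inner (ρ.integrated h μ (D.invol hD f) x) y = c.inner x (ρ.integrated h μ f y) := by
  let ip : InnerProductSpace 𝕜 X :=
    { (inferInstance : NormedSpace 𝕜 X), c with
      norm_sq_eq_re_inner := fun x => (hc x).symm
      conj_inner_symm := c.conj_inner_symm
      add_left := c.add_left
      smul_left := c.smul_left }
  change inner 𝕜 (ρ.integrated h μ (D.invol hD f) x) y = inner 𝕜 x (ρ.integrated h μ f y)
  change ∀ a x y, inner 𝕜 (ρ.pi (star a) x) y = inner 𝕜 x (ρ.pi a y) at hpi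
  change ∀ s x y, inner 𝕜 (ρ.U s x) (ρ.U s y) = inner 𝕜 x y at hU
  rw [← inner_conj_symm, CovRep.integrated_apply, CovRep.integrated_apply]
  have e1 := vint_clm 𝕜 μ (innerSL 𝕜 y) (ρ.integrable_integrand h μ (D.invol hD f) x)
  have e2 := vint_clm 𝕜 μ (innerSL 𝕜 x) (ρ.integrable_integrand h μ f y)
  simp only [innerSL_apply_apply] at e1 e2
  rw [← e1, ← e2]
  have hcont : Continuous fun s => inner 𝕜 x (ρ.pi (f s) (ρ.U s y)) :=
    (innerSL 𝕜 x).continuous.comp (ρ.continuous_integrand h f y)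
  have hsupp : HasCompactSupport fun s => inner 𝕜 x (ρ.pi (f s) (ρ.U s y)) :=
    (ρ.hasCompactSupport_integrand f y).comp_left (g := fun z => inner 𝕜 x z) (by simp)
  rw [← vint_modular_inv μ 𝕜 hcont hsupp]
  have hpt : ∀ s, inner 𝕜 y (ρ.pi (D.invol hD f s) (ρ.U s x))
      = starRingEnd 𝕜 ((modular s⁻¹ : 𝕜) • inner 𝕜 x (ρ.pi (f s⁻¹) (ρ.U s⁻¹ y))) := by
    intro s
    have h1 : y = ρ.U s (ρ.U s⁻¹ y) := by rw [← CovRep.U_mul_apply]; simp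
    rw [DynSys.invol_apply, map_smul, _root_.smul_apply, inner_smul_right, ← CovRep.U_mul_pi,
      smul_eq_mul, map_mul, RCLike.conj_ofReal, inner_conj_symm]
    congr 1
    conv_lhs => rw [h1]
    rw [hU, ← inner_conj_symm, hpi, inner_conj_symm]
  simp only [hpt]
  have hint : Integrable (fun s => (modular s⁻¹ : 𝕜) • inner 𝕜 x (ρ.pi (f s⁻¹) (ρ.U s⁻¹ y))) μ := by
    have h2 : Continuous fun s : G => (modular s⁻¹ : 𝕜) :=
      RCLike.continuous_ofReal.comp (continuous_modular.comp continuous_inv)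
    refine (h2.smul (hcont.comp continuous_inv)).integrable_of_hasCompactSupport ?_
    exact (hsupp.comp_homeomorph (Homeomorph.inv G)).smul_left
  rw [vint_conj μ hint, RCLike.conj_conj]

/-- For involutive `(π, U)`, the seminorm `f ↦ ‖π ⋊ U (f)‖` is invariant under the involution. -/
lemma CovRep.IsInvolutive.norm_integrated_invol {D : DynSys 𝕜 A G} (hD : D.IsInvolutive)
    {X : Type*} [NormedAddCommGroup X] [NormedSpace 𝕜 X] [CompleteSpace X] {ρ : CovRep D X}
    (hρ : ρ.IsInvolutive) (h : ρ.IsContinuous) (μ : Measure G) [μ.IsHaarMeasure]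
    (f : C_c(G, A)) :
    ‖ρ.integrated h μ (D.invol hD f)‖ = ‖ρ.integrated h μ f‖ := by
  obtain ⟨c, hc, hpi, hU⟩ := hρ
  have key := ρ.inner_integrated_invol hD h μ c hc hpi hU f
  let ip : InnerProductSpace 𝕜 X :=
    { (inferInstance : NormedSpace 𝕜 X), c with
      norm_sq_eq_re_inner := fun x => (hc x).symm
      conj_inner_symm := c.conj_inner_symm
      add_left := c.add_left
      smul_left := c.smul_left }
  have : ρ.integrated h μ (D.invol hD f) = ContinuousLinearMap.adjoint (ρ.integrated h μ f) :=
    (ContinuousLinearMap.eq_adjoint_iff _ _).2 key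
  rw [this]
  exact (ContinuousLinearMap.adjoint (𝕜 := 𝕜) (E := X) (F := X)).norm_map _

namespace RepClass

variable [IsScalarTower 𝕜 A A] [SMulCommClass 𝕜 A A] {D : DynSys 𝕜 A G} (R : RepClass.{v} D)
  (μ : Measure G) [μ.IsHaarMeasure]

/-- All elements of the class are involutive. -/
def IsInvolutive : Prop := ∀ ρ ∈ R.carrier, ρ.2.IsInvolutive

/-- The involution of the crossed product when the system and the class are involutive: the
continuous extension of the involution of `C_c(G, A)`. -/
def cpStar (hD : D.IsInvolutive) : R.CP μ → R.CP μ :=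
  UniformSpace.Completion.map fun f => R.toPre μ (D.invol hD ((R.toPre μ).symm f))

lemma isometry_invol (hD : D.IsInvolutive) (hR : R.IsInvolutive) :
    Isometry fun f => R.toPre μ (D.invol hD ((R.toPre μ).symm f)) := by
  refine Isometry.of_dist_eq fun f g => ?_
  rw [dist_eq_norm, dist_eq_norm, ← map_sub, ← DynSys.invol_sub, ← map_sub, norm_toPre]
  change _ = R.sigma μ ((R.toPre μ).symm (f - g))
  rw [sigma_apply, sigma_apply]
  congr 1
  ext ρ
  exact (hR _ ρ.2).norm_integrated_invol hD _ μ _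

/-- In the involutive case, the involution of the crossed product is continuous and extends the
involution of `C_c(G, A)`. -/
lemma continuous_cpStar (hD : D.IsInvolutive) : Continuous (R.cpStar μ hD) :=
  UniformSpace.Completion.continuous_map

lemma cpStar_q (hD : D.IsInvolutive) (hR : R.IsInvolutive) (f : C_c(G, A)) :
    R.cpStar μ hD (R.q μ f) = R.q μ (D.invol hD f) :=
  UniformSpace.Completion.map_coe (R.isometry_invol μ hD hR).uniformContinuous _

end RepClass

end Involutive

end
end CrossedProd

open CrossedProd MeasureTheory

universe u𝕜 uA uG v w

/-!
If `e_i` is a bounded approximate left identity of `A` and `z` runs through approximate Dirac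
measures at the identity of `G`, then the elements `q(z ⊗ e_i)` form a bounded approximate left
identity of the crossed product `B`. Hence a non-degenerate bounded representation `T` of `B`
extends to the left centralizers: `T (L (e_j))` converges strongly along such a net `e_j`, and the
limit is forced by `T̄(L) T(b) x = T(L b) x`.

The crossed product carries the left regular covariant representation `(i_A, i_G)`. Its integrated
form is left multiplication, because the elements of the class separate the points of `B`. The
orbit maps `b ↦ T b x` intertwine `(i_A, i_G)` with the pair separated from `T`, so this pair
integrates back to `T`. As the vectors `T b x` are total, a covariant representation with integrated
form `T` is determined by `T`. In the same way closed invariant subspaces, intertwining operators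
and involutivity pass between a covariant representation and its integrated form.
-/

namespace CrossedProd

noncomputable section

/-! ### Bounded nets of operators -/

section BoundedNets

variable {𝕜 X Y ι : Type*} [RCLike 𝕜] [NormedAddCommGroup X] [NormedSpace 𝕜 X]
  [NormedAddCommGroup Y] [NormedSpace 𝕜 Y] {l : Filter ι} {S : ι → X →L[𝕜] Y} {M : ℝ} {s : Set X}

lemma exists_mem_eventually_norm_apply_sub_lt (hM : ∀ᶠ i in l, ‖S i‖ ≤ M) (hs : Dense s) (x : X)
    {ε : ℝ} (hε : 0 < ε) : ∃ y ∈ s, ∀ᶠ i in l, ‖S i x - S i y‖ < ε := by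
  obtain ⟨y, hxy, hy⟩ := Metric.dense_iff.1 hs x (ε / (|M| + 1)) (by positivity)
  rw [mem_ball_iff_norm', lt_div_iff₀' (by positivity)] at hxy
  refine ⟨y, hy, hM.mono fun i hi => ?_⟩
  rw [← map_sub]
  exact ((S i).le_of_opNorm_le (hi.trans (by linarith [le_abs_self M])) _).trans_lt hxy

lemma tendsto_apply_of_dense_span {S₀ : X →L[𝕜] Y} (hM : ∀ᶠ i in l, ‖S i‖ ≤ M)
    (hs : Dense (Submodule.span 𝕜 s : Set X))
    (h : ∀ x ∈ s, Tendsto (fun i => S i x) l (𝓝 (S₀ x))) (x : X) :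
    Tendsto (fun i => S i x) l (𝓝 (S₀ x)) := by
  have hspan : ∀ y ∈ Submodule.span 𝕜 s, Tendsto (fun i => S i y) l (𝓝 (S₀ y)) := by
    intro y hy
    induction hy using Submodule.span_induction with
    | mem y hy => exact h y hy
    | zero => simpa only [map_zero] using tendsto_const_nhds
    | add y z _ _ hy hz => simpa only [map_add] using hy.add hz
    | smul c y _ hy => simpa only [map_smul] using hy.const_smul c
  have hdiff : ∀ᶠ i in l, ‖S i - S₀‖ ≤ M + ‖S₀‖ :=
    hM.mono fun i hi => (norm_sub_le _ _).trans (by gcongr)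
  rw [tendsto_iff_norm_sub_tendsto_zero, Metric.tendsto_nhds]
  intro ε hε
  obtain ⟨y, hy, hxy⟩ := exists_mem_eventually_norm_apply_sub_lt hdiff hs x (half_pos hε)
  filter_upwards [hxy, Metric.tendsto_nhds.1 (hspan y hy) (ε / 2) (half_pos hε)] with i hi hi'
  rw [dist_eq_norm] at hi'
  rw [dist_zero_right, norm_norm]
  exact (norm_le_norm_sub_add _ _).trans_lt ((add_lt_add hi hi').trans_eq (add_halves ε))

lemma exists_tendsto_apply_of_dense_span [l.NeBot] [CompleteSpace Y]
    (hM : ∀ᶠ i in l, ‖S i‖ ≤ M) (hs : Dense (Submodule.span 𝕜 s : Set X))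
    (h : ∀ x ∈ s, ∃ y, Tendsto (fun i => S i x) l (𝓝 y)) (x : X) :
    ∃ y, Tendsto (fun i => S i x) l (𝓝 y) := by
  have hspan : ∀ y ∈ Submodule.span 𝕜 s, Cauchy (map (fun i => S i y) l) := by
    intro y hy
    rw [cauchy_map_iff_exists_tendsto]
    induction hy using Submodule.span_induction with
    | mem y hy => exact h y hy
    | zero => exact ⟨0, by simpa only [map_zero] using tendsto_const_nhds⟩
    | add y z _ _ hy hz =>
      exact ⟨_, by simpa only [map_add] using hy.choose_spec.add hz.choose_spec⟩
    | smul c y _ hy => exact ⟨_, by simpa only [map_smul] using hy.choose_spec.const_smul c⟩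
  rw [← cauchy_map_iff_exists_tendsto, Metric.cauchy_iff]
  refine ⟨inferInstance, fun ε hε => ?_⟩
  obtain ⟨y, hy, hxy⟩ := exists_mem_eventually_norm_apply_sub_lt hM hs x
    (show 0 < ε / 3 by positivity)
  obtain ⟨t, ht, hyt⟩ := (Metric.cauchy_iff.1 (hspan y hy)).2 (ε / 3) (by positivity)
  refine ⟨(fun i => S i x) '' {i | S i y ∈ t ∧ ‖S i x - S i y‖ < ε / 3},
    image_mem_map (inter_mem ht hxy), ?_⟩
  rintro _ ⟨i, ⟨hit, hi⟩, rfl⟩ _ ⟨j, ⟨hjt, hj⟩, rfl⟩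
  rw [← dist_eq_norm] at hi hj
  rw [dist_comm] at hj
  linarith [dist_triangle4 (S i x) (S i y) (S j y) (S j x), hyt _ hit _ hjt]

lemma exists_clm_tendsto_of_dense_span [l.NeBot] [CompleteSpace Y]
    (hM : ∀ᶠ i in l, ‖S i‖ ≤ M) (hs : Dense (Submodule.span 𝕜 s : Set X))
    (h : ∀ x ∈ s, ∃ y, Tendsto (fun i => S i x) l (𝓝 y)) :
    ∃ S₀ : X →L[𝕜] Y, ‖S₀‖ ≤ M ∧ ∀ x, Tendsto (fun i => S i x) l (𝓝 (S₀ x)) := by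
  choose φ hφ using exists_tendsto_apply_of_dense_span hM hs h
  have hφM : ∀ x, ‖φ x‖ ≤ M * ‖x‖ := fun x =>
    le_of_tendsto (hφ x).norm (hM.mono fun i hi => (S i).le_of_opNorm_le hi x)
  obtain ⟨i, hi⟩ := hM.exists
  refine ⟨(linearMapOfTendsto φ (fun i => (S i : X →ₗ[𝕜] Y)) (tendsto_pi_nhds.2 hφ)).mkContinuous
    M hφM, LinearMap.mkContinuous_norm_le _ ((norm_nonneg _).trans hi) _, hφ⟩

lemma tendsto_apply_apply {x : ι → X} {c : X} {d : Y} (hM : ∀ᶠ i in l, ‖S i‖ ≤ M)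
    (hS : Tendsto (fun i => S i c) l (𝓝 d)) (hx : Tendsto x l (𝓝 c)) :
    Tendsto (fun i => S i (x i)) l (𝓝 d) := by
  have hsmall : Tendsto (fun i => S i (x i - c)) l (𝓝 0) := by
    refine squeeze_zero_norm' (hM.mono fun i hi => (S i).le_of_opNorm_le hi (x i - c)) ?_
    simpa only [mul_zero] using (tendsto_iff_norm_sub_tendsto_zero.1 hx).const_mul M
  simpa only [map_sub, sub_add_cancel, zero_add] using hsmall.add hS

lemma tendstoUniformlyOn_of_isCompact {S₀ : X →L[𝕜] Y} (hM : ∀ᶠ i in l, ‖S i‖ ≤ M)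
    (h : ∀ x, Tendsto (fun i => S i x) l (𝓝 (S₀ x))) {K : Set X} (hK : IsCompact K) :
    TendstoUniformlyOn (fun i x => S i x) S₀ l K := by
  rw [← tendstoLocallyUniformlyOn_iff_tendstoUniformlyOn_of_compact hK,
    tendstoLocallyUniformlyOn_iff_forall_tendsto]
  intro x _
  have hfst : Tendsto Prod.fst (l ×ˢ 𝓝[K] x) l := tendsto_fst
  have hsnd : Tendsto Prod.snd (l ×ˢ 𝓝[K] x) (𝓝 x) := tendsto_snd.mono_right nhdsWithin_le_nhds
  have hS : Tendsto (fun p : ι × X => S p.1 p.2) (l ×ˢ 𝓝[K] x) (𝓝 (S₀ x)) :=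
    tendsto_apply_apply (hfst.eventually hM) ((h x).comp hfst) hsnd
  exact (((S₀.continuous.tendsto x).comp hsnd).prodMk_nhds hS).mono_right (nhds_le_uniformity _)

lemma continuous_apply_of_dense_span {Z : Type*} [TopologicalSpace Z] {V : Z → X →L[𝕜] Y}
    (hV : ∀ r, ∃ M : ℝ, ∀ᶠ t in 𝓝 r, ‖V t‖ ≤ M) (hs : Dense (Submodule.span 𝕜 s : Set X))
    (h : ∀ x ∈ s, Continuous fun r => V r x) (x : X) : Continuous fun r => V r x :=
  continuous_iff_continuousAt.2 fun r =>
    (hV r).elim fun _ hM => tendsto_apply_of_dense_span hM hs (fun x hx => (h x hx).tendsto r) x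

lemma dense_span_of_subset_closure {t : Set X} (hs : Dense (Submodule.span 𝕜 s : Set X))
    (h : s ⊆ closure (Submodule.span 𝕜 t : Set X)) : Dense (Submodule.span 𝕜 t : Set X) := by
  have hle : Submodule.span 𝕜 s ≤ (Submodule.span 𝕜 t).topologicalClosure :=
    Submodule.span_le.2 h
  exact dense_closure.1 (hs.mono hle)

end BoundedNets

/-! ### Representations and left centralizers -/

section Extension

variable {𝕜 B X Y ι : Type*} [RCLike 𝕜] [NonUnitalNormedRing B] [NormedSpace 𝕜 B]
  [NormedAddCommGroup X] [NormedSpace 𝕜 X] [NormedAddCommGroup Y] [NormedSpace 𝕜 Y]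

/-- The net `e` along the filter `l` is a bounded approximate left identity. Filters, rather than
directed sets as in `HasBoundedApproxLeftId`, allow a product of such nets to be formed with the
filter of small bump functions on a group. -/
structure IsBddApproxLeftId (l : Filter ι) (e : ι → B) : Prop where
  bounded : ∃ M : ℝ, ∀ᶠ i in l, ‖e i‖ ≤ M
  tendsto_mul : ∀ b, Tendsto (fun i => e i * b) l (𝓝 b)

lemma HasBoundedApproxLeftId.exists_isBddApproxLeftId {A : Type uA} [NonUnitalNormedRing A]
    (hA : HasBoundedApproxLeftId A) :
    ∃ (ι : Type uA) (l : Filter ι) (e : ι → A), l.NeBot ∧ IsBddApproxLeftId l e := by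
  obtain ⟨ι, _, _, _, e, ⟨M, hM⟩, he⟩ := hA
  exact ⟨ι, atTop, e, inferInstance, ⟨M, Eventually.of_forall hM⟩, he⟩

lemma rep_mul_apply (T : B →ₙₐ[𝕜] (X →L[𝕜] X)) (b c : B) (x : X) :
    T (b * c) x = T b (T c x) := by
  rw [map_mul, mul_apply_eq_comp]

lemma IsNondegRep.ext_clm {T : B →ₙₐ[𝕜] (X →L[𝕜] X)} (hn : IsNondegRep T) {S S' : X →L[𝕜] Y}
    (h : ∀ b x, S (T b x) = S' (T b x)) : S = S' :=
  ContinuousLinearMap.ext_on hn (by rintro _ ⟨b, x, rfl⟩; exact h b x)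

namespace IsBddRep

variable {T : B →ₙₐ[𝕜] (X →L[𝕜] X)} (hT : IsBddRep T)

/-- A bounded representation as a bounded operator into the bounded operators. -/
def toCLM : B →L[𝕜] (X →L[𝕜] X) :=
  LinearMap.mkContinuousOfExistsBound (T : B →ₗ[𝕜] (X →L[𝕜] X)) hT

/-- The orbit map `b ↦ T b x` of a vector `x`. It intertwines left multiplication on `B` with
`T`. -/
def orbit (x : X) : B →L[𝕜] X := hT.toCLM.flip x

@[simp] lemma orbit_apply (x : X) (b : B) : hT.orbit x b = T b x := rfl

lemma norm_apply_le (b : B) : ‖T b‖ ≤ ‖hT.toCLM‖ * ‖b‖ := hT.toCLM.le_opNorm b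

end IsBddRep

section Net

variable {l : Filter ι} {e : ι → B} {T : B →ₙₐ[𝕜] (X →L[𝕜] X)}

lemma IsBddApproxLeftId.tendsto_rep (he : IsBddApproxLeftId l e) (hT : IsBddRep T)
    (hn : IsNondegRep T) (x : X) : Tendsto (fun i => T (e i) x) l (𝓝 x) := by
  obtain ⟨M, hM⟩ := he.bounded
  have hbdd : ∀ᶠ i in l, ‖T (e i)‖ ≤ ‖hT.toCLM‖ * M :=
    hM.mono fun i hi => (hT.norm_apply_le _).trans (by gcongr)
  refine tendsto_apply_of_dense_span (S₀ := ContinuousLinearMap.id 𝕜 X) hbdd hn ?_ x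
  rintro _ ⟨b, y, rfl⟩
  simp only [← rep_mul_apply]
  exact ((hT.orbit y).continuous.tendsto b).comp (he.tendsto_mul b)

variable [IsScalarTower 𝕜 B B]

/-- The operator is the strong limit of the net `T (L (e i))`. -/
lemma IsBddApproxLeftId.exists_extension_apply [l.NeBot] [CompleteSpace X]
    (he : IsBddApproxLeftId l e) (hT : IsBddRep T) (hn : IsNondegRep T) :
    ∃ C : ℝ, ∀ L : leftCentralizers 𝕜 B, ∃ S : X →L[𝕜] X,
      (∀ b x, S (T b x) = T (L.1 b) x) ∧ ‖S‖ ≤ C * ‖L‖ := by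
  obtain ⟨M, hM⟩ := he.bounded
  refine ⟨‖hT.toCLM‖ * M, fun L => ?_⟩
  have hbdd : ∀ᶠ i in l, ‖T (L.1 (e i))‖ ≤ ‖hT.toCLM‖ * M * ‖L‖ := hM.mono fun i hi =>
    calc ‖T (L.1 (e i))‖ ≤ ‖hT.toCLM‖ * (‖L‖ * M) :=
          (hT.norm_apply_le _).trans (by gcongr; exact L.1.le_opNorm_of_le hi)
      _ = ‖hT.toCLM‖ * M * ‖L‖ := by ring
  have hlim : ∀ b x, Tendsto (fun i => T (L.1 (e i)) (T b x)) l (𝓝 (T (L.1 b) x)) := by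
    intro b x
    have hL : ∀ i, T (L.1 (e i)) (T b x) = hT.orbit x (L.1 (e i * b)) := fun i => by
      rw [L.2, hT.orbit_apply, rep_mul_apply]
    simp only [hL]
    exact (((hT.orbit x).comp L.1).continuous.tendsto b).comp (he.tendsto_mul b)
  obtain ⟨S, hS, hSlim⟩ := exists_clm_tendsto_of_dense_span hbdd hn
    (by rintro _ ⟨b, x, rfl⟩; exact ⟨_, hlim b x⟩)
  exact ⟨S, fun b x => tendsto_nhds_unique (hSlim _) (hlim b x), hS⟩

variable [SMulCommClass 𝕜 B B]

lemma mul_leftMul (L : leftCentralizers 𝕜 B) (b : B) : L * leftMul 𝕜 b = leftMul 𝕜 (L.1 b) :=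
  Subtype.ext (ContinuousLinearMap.ext fun c => L.2 b c)

lemma extension_apply {T' : leftCentralizers 𝕜 B →ₙₐ[𝕜] (X →L[𝕜] X)}
    (hT' : ∀ b, T' (leftMul 𝕜 b) = T b) (L : leftCentralizers 𝕜 B) (b : B) (x : X) :
    T' L (T b x) = T (L.1 b) x := by
  rw [← hT', ← hT', ← mul_leftMul, map_mul, mul_apply_eq_comp]

lemma IsNondegRep.extension_unique (hn : IsNondegRep T)
    {T' T'' : leftCentralizers 𝕜 B →ₙₐ[𝕜] (X →L[𝕜] X)} (hT' : ∀ b, T' (leftMul 𝕜 b) = T b)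
    (hT'' : ∀ b, T'' (leftMul 𝕜 b) = T b) (L : leftCentralizers 𝕜 B) : T' L = T'' L :=
  hn.ext_clm fun b x => by rw [extension_apply hT', extension_apply hT'']

lemma IsBddApproxLeftId.exists_extension [l.NeBot] [CompleteSpace X]
    (he : IsBddApproxLeftId l e) (hT : IsBddRep T) (hn : IsNondegRep T) :
    ∃ Tbar : leftCentralizers 𝕜 B →ₐ[𝕜] (X →L[𝕜] X),
      (∀ b, Tbar (leftMul 𝕜 b) = T b) ∧ ∃ C : ℝ, ∀ L, ‖Tbar L‖ ≤ C * ‖L‖ := by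
  obtain ⟨C, hC⟩ := he.exists_extension_apply hT hn
  choose S hS hSC using hC
  refine ⟨AlgHom.ofLinearMap { toFun := S, map_add' := ?_, map_smul' := ?_ } ?_ ?_, ?_, C, hSC⟩
  · exact fun L L' => hn.ext_clm fun b x => by
      simp only [_root_.add_apply, hS, AddMemClass.coe_add, map_add]
  · exact fun c L => hn.ext_clm fun b x => by
      simp only [_root_.smul_apply, hS, RingHom.id_apply, SetLike.val_smul, map_smul]
  · exact hn.ext_clm fun b x => hS 1 b x
  · intro L L'
    refine hn.ext_clm fun b x => ?_
    change S (L * L') (T b x) = S L (S L' (T b x))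
    simp only [hS, MulMemClass.coe_mul, mul_apply_eq_comp]
  · refine fun b => hn.ext_clm fun c x => ?_
    change S (leftMul 𝕜 b) (T c x) = T b (T c x)
    rw [hS, ← rep_mul_apply]
    rfl

end Net

end Extension

/-! ### Small bump functions on the group -/

section Bump

variable {G : Type*} [TopologicalSpace G] [MeasurableSpace G]

/-- The filter on `C_c(G, ℝ)` along which non-negative functions of integral one have support
shrinking to the identity: they are approximate Dirac measures at the identity. -/
def bumpFilter [Group G] (μ : Measure G) : Filter C_c(G, ℝ) :=
  comap (fun z : C_c(G, ℝ) => tsupport z) (𝓝 1).smallSets ⊓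
    𝓟 {z | (∀ s, 0 ≤ z s) ∧ ∫ s, z s ∂μ = 1}

lemma hasBasis_bumpFilter [Group G] (μ : Measure G) :
    (bumpFilter μ).HasBasis (fun V => V ∈ 𝓝 1)
      fun V => {z | tsupport z ⊆ V ∧ (∀ s, 0 ≤ z s) ∧ ∫ s, z s ∂μ = 1} :=
  ((hasBasis_smallSets _).comap _).inf_principal _

section Average

variable [OpensMeasurableSpace G] {μ : Measure G} [IsFiniteMeasureOnCompacts μ]
  {𝕜 E : Type*} [RCLike 𝕜] [NormedAddCommGroup E] [NormedSpace 𝕜 E] {h : G → E}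

lemma integrable_ofReal_smul (z : C_c(G, ℝ)) (hh : Continuous h) :
    Integrable (fun s => (z s : 𝕜) • h s) μ :=
  ((RCLike.continuous_ofReal.comp z.continuous).smul hh).integrable_of_hasCompactSupport
    (z.hasCompactSupport.mono fun s hs hz => hs (by simp [hz]))

lemma norm_vint_smul_sub_le [CompleteSpace E] {z : C_c(G, ℝ)} (hz0 : ∀ s, 0 ≤ z s)
    (hz1 : ∫ s, z s ∂μ = 1) (hh : Continuous h) {y : E} {ε : ℝ}
    (hε : ∀ s ∈ tsupport z, ‖h s - y‖ ≤ ε) :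
    ‖vint 𝕜 μ (fun s => (z s : 𝕜) • h s) - y‖ ≤ ε := by
  let : NormedSpace ℝ E := NormedSpace.restrictScalars ℝ 𝕜 E
  have hz : Integrable z μ := z.continuous.integrable_of_hasCompactSupport z.hasCompactSupport
  have hzh : Integrable (fun s => z s • h s) μ := integrable_ofReal_smul (𝕜 := 𝕜) z hh
  have hy : ∫ s, z s • y ∂μ = y := by rw [integral_smul_const, hz1, one_smul]
  have hle : ∀ s, ‖z s • (h s - y)‖ ≤ z s * ε := fun s => by
    rw [norm_smul, Real.norm_of_nonneg (hz0 s)]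
    by_cases hs : s ∈ tsupport z
    · exact mul_le_mul_of_nonneg_left (hε s hs) (hz0 s)
    · rw [image_eq_zero_of_notMem_tsupport hs, zero_mul, zero_mul]
  calc ‖vint 𝕜 μ (fun s => (z s : 𝕜) • h s) - y‖
      = ‖(∫ s, z s • h s ∂μ) - ∫ s, z s • y ∂μ‖ := by rw [hy]; rfl
    _ = ‖∫ s, z s • (h s - y) ∂μ‖ := by
        simp only [smul_sub]
        rw [integral_sub hzh (hz.smul_const y)]
    _ ≤ ∫ s, z s * ε ∂μ := norm_integral_le_of_norm_le (hz.mul_const ε) (Eventually.of_forall hle)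
    _ = ε := by rw [integral_mul_const, hz1, one_mul]

lemma tendsto_vint_smul [Group G] [CompleteSpace E] (hh : Continuous h) :
    Tendsto (fun z : C_c(G, ℝ) => vint 𝕜 μ fun s => (z s : 𝕜) • h s) (bumpFilter μ)
      (𝓝 (h 1)) := by
  refine Metric.nhds_basis_closedBall.tendsto_right_iff.2 fun ε hε => ?_
  have hV : h ⁻¹' Metric.closedBall (h 1) ε ∈ 𝓝 (1 : G) :=
    hh.continuousAt (Metric.closedBall_mem_nhds (h 1) hε)
  filter_upwards [(hasBasis_bumpFilter μ).mem_of_mem hV] with z ⟨hzV, hz0, hz1⟩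
  rw [mem_closedBall_iff_norm]
  exact norm_vint_smul_sub_le hz0 hz1 hh fun s hs => mem_closedBall_iff_norm.1 (hzV hs)

end Average

section Haar

variable [Group G] [IsTopologicalGroup G] [LocallyCompactSpace G] [BorelSpace G] (μ : Measure G)
  [μ.IsHaarMeasure]

lemma exists_bump {V : Set G} (hV : V ∈ 𝓝 (1 : G)) :
    ∃ z : C_c(G, ℝ), tsupport z ⊆ V ∧ (∀ s, 0 ≤ z s) ∧ ∫ s, z s ∂μ = 1 := by
  obtain ⟨K, ⟨hK, -, hKc⟩, hKV⟩ := (isCompact_isClosed_basis_nhds (1 : G)).mem_iff.1 hV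
  obtain ⟨f, hf1, hf0, hfc, hf⟩ := exists_continuous_one_zero_of_isCompact
    (isCompact_singleton (x := (1 : G))) (isOpen_interior (s := K)).isClosed_compl
    (Set.disjoint_singleton_left.2 fun h => h (mem_interior_iff_mem_nhds.2 hK))
  have hpos : 0 < ∫ s, f s ∂μ := f.continuous.integral_pos_of_hasCompactSupport_nonneg_nonzero
    hfc (fun s => (hf s).1) (x := 1) (by rw [hf1 rfl]; exact one_ne_zero)
  have hfK : tsupport f ⊆ K := closure_minimal
    (fun s hs => by_contra fun h => hs (hf0 fun h' => h (interior_subset h'))) hKc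
  refine ⟨(∫ s, f s ∂μ)⁻¹ • ⟨f, hfc⟩, ?_, fun s => mul_nonneg (inv_nonneg.2 hpos.le) (hf s).1, ?_⟩
  · exact (tsupport_smul_subset_right (fun _ => (∫ s, f s ∂μ)⁻¹) f).trans (hfK.trans hKV)
  · exact (integral_const_mul _ _).trans (inv_mul_cancel₀ hpos.ne')

instance : (bumpFilter μ).NeBot :=
  (hasBasis_bumpFilter μ).neBot_iff.2 fun hV => exists_bump μ hV

end Haar

end Bump

section ElementaryTensor

variable (𝕜 : Type*) {A G : Type*} [RCLike 𝕜] [NonUnitalNormedRing A] [NormedSpace 𝕜 A]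
  [TopologicalSpace G]

/-- The elementary tensor `s ↦ z(s) a` in `C_c(G, A)`. -/
def elemTensor (z : C_c(G, ℝ)) (a : A) : C_c(G, A) where
  toFun s := (z s : 𝕜) • a
  continuous_toFun := (RCLike.continuous_ofReal.comp z.continuous).smul continuous_const
  hasCompactSupport' := z.hasCompactSupport.mono fun s hs hz => hs (by simp [hz])

variable {𝕜}

lemma elemTensor_apply (z : C_c(G, ℝ)) (a : A) (s : G) :
    elemTensor 𝕜 z a s = (z s : 𝕜) • a := rfl

lemma CovRep.integrated_elemTensor [Group G] [IsTopologicalGroup G] [LocallyCompactSpace G]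
    [CompleteSpace A] [MeasurableSpace G] [BorelSpace G] {D : DynSys 𝕜 A G} {X : Type*}
    [NormedAddCommGroup X] [NormedSpace 𝕜 X] [CompleteSpace X] (ρ : CovRep D X)
    (h : ρ.IsContinuous) (μ : Measure G) [IsFiniteMeasureOnCompacts μ] (z : C_c(G, ℝ)) (a : A)
    (x : X) :
    ρ.integrated h μ (elemTensor 𝕜 z a) x = ρ.pi a (vint 𝕜 μ fun s => (z s : 𝕜) • ρ.U s x) := by
  rw [CovRep.integrated_apply, ← vint_clm 𝕜 μ _ (integrable_ofReal_smul z (h.2 x))]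
  simp only [elemTensor_apply, map_smul, _root_.smul_apply]

end ElementaryTensor

/-! ### Norm estimates and strong continuity in the crossed product -/

section System

variable {𝕜 A G : Type*} [RCLike 𝕜] [NonUnitalNormedRing A] [NormedSpace 𝕜 A]
  [Group G] [TopologicalSpace G] [IsTopologicalGroup G] [LocallyCompactSpace G] [CompleteSpace A]
  [MeasurableSpace G] [BorelSpace G]

namespace RepClass

variable [IsScalarTower 𝕜 A A] [SMulCommClass 𝕜 A A] {D : DynSys 𝕜 A G} (R : RepClass.{v} D)
  (μ : Measure G) [μ.IsHaarMeasure]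

lemma exists_sigma_le_integral {K : Set G} (hK : IsCompact K) :
    ∃ C : ℝ, 0 ≤ C ∧
      ∀ f : C_c(G, A), (∀ s ∉ K, f s = 0) → R.sigma μ f ≤ C * ∫ s, ‖f s‖ ∂μ := by
  obtain ⟨C, ν, hν, h⟩ := R.uniformlyBounded
  obtain ⟨M, hM⟩ := hν _ hK.closure
  refine ⟨C * M, by positivity, fun f hf => R.sigma_le μ fun ρ => ?_⟩
  have hfK : tsupport f ⊆ closure K := closure_mono fun s hs => by_contra fun h => hs (hf s h)
  exact ρ.1.2.norm_integrated_le _ μ f C.2 M.2 (h _ ρ.2).1 fun s hs =>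
    ((h _ ρ.2).2 s).trans (NNReal.coe_le_coe.2 (hM ⟨s, hfK hs, rfl⟩))

lemma exists_sigma_le_of_norm_le {K : Set G} (hK : IsCompact K) :
    ∃ C : ℝ, 0 ≤ C ∧ ∀ (f : C_c(G, A)) (ε : ℝ), (∀ s ∉ K, f s = 0) → (∀ s ∈ K, ‖f s‖ ≤ ε) →
      R.sigma μ f ≤ C * ε := by
  obtain ⟨C, hC0, hC⟩ := R.exists_sigma_le_integral μ hK
  refine ⟨C * μ.real K, by positivity, fun f ε hf hε => (hC f hf).trans ?_⟩
  have hint : ∫ s, ‖f s‖ ∂μ ≤ ε * μ.real K := by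
    rw [← setIntegral_eq_integral_of_forall_compl_eq_zero
      fun s hs => norm_eq_zero.2 (hf s hs)]
    exact (le_abs_self _).trans (norm_setIntegral_le_of_norm_le_const (f := fun s => ‖f s‖)
      hK.measure_lt_top fun s hs => (norm_norm _).trans_le (hε s hs))
  rw [mul_assoc, mul_comm (μ.real K)]
  gcongr

lemma tendsto_q_of_tendstoUniformlyOn {ι : Type*} {l : Filter ι} {F : ι → C_c(G, A)}
    {f : C_c(G, A)} {K : Set G} (hK : IsCompact K) (hF : ∀ᶠ i in l, ∀ s ∉ K, F i s = 0)
    (hf : ∀ s ∉ K, f s = 0) (h : TendstoUniformlyOn (fun i => F i) f l K) :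
    Tendsto (fun i => R.q μ (F i)) l (𝓝 (R.q μ f)) := by
  obtain ⟨C, hC0, hC⟩ := R.exists_sigma_le_of_norm_le μ hK
  refine Metric.nhds_basis_closedBall.tendsto_right_iff.2 fun ε hε => ?_
  filter_upwards [hF, Metric.tendstoUniformlyOn_iff.1 h (ε / (C + 1)) (by positivity)] with i hi hfi
  have hnorm : ∀ s ∈ K, ‖(F i - f) s‖ ≤ ε / (C + 1) := fun s hs =>
    (dist_eq_norm' (f s) (F i s)).symm.trans_le (hfi s hs).le
  have hzero : ∀ s ∉ K, (F i - f) s = 0 := fun s hs => by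
    simp only [CompactlySupportedContinuousMap.coe_sub, Pi.sub_apply, hi s hs, hf s hs, sub_zero]
  rw [mem_closedBall_iff_norm, ← map_sub, norm_q]
  calc R.sigma μ (F i - f) ≤ C * (ε / (C + 1)) := hC _ _ hzero hnorm
    _ ≤ (C + 1) * (ε / (C + 1)) := by gcongr; linarith
    _ = ε := by field_simp

lemma norm_lift_le {S : C_c(G, A) →ₗ[𝕜] C_c(G, A)} {C : ℝ} (hC0 : 0 ≤ C)
    (hC : ∀ f, R.sigma μ (S f) ≤ C * R.sigma μ f) : ‖R.lift μ S ⟨C, hC⟩‖ ≤ C := by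
  refine ContinuousLinearMap.opNorm_le_bound _ hC0
    (R.CP_induction μ (isClosed_le (by fun_prop) (by fun_prop)) fun f => ?_)
  rw [lift_q, norm_q, norm_q]
  exact hC f

lemma exists_norm_iA_le : ∃ C : ℝ, 0 ≤ C ∧ ∀ a, ‖R.iA μ a‖ ≤ C * ‖a‖ := by
  obtain ⟨C, ν, -, h⟩ := R.uniformlyBounded
  refine ⟨C, C.2, fun a => R.norm_lift_le μ (by positivity) fun f => R.sigma_le μ fun ρ => ?_⟩
  rw [normAt, CovRep.integrated_iAfun]
  exact norm_mul_le_of_le ((h _ ρ.2).1 a) (R.normAt_le_sigma μ f ρ)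

lemma exists_norm_iG_le (r : G) : ∃ M : ℝ, ∀ᶠ t in 𝓝 r, ‖R.iG μ t‖ ≤ M := by
  obtain ⟨C, ν, hν, h⟩ := R.uniformlyBounded
  obtain ⟨K, hK, hKr⟩ := exists_compact_mem_nhds r
  obtain ⟨M, hM⟩ := hν K hK
  refine ⟨M, ?_⟩
  filter_upwards [hKr] with t ht
  refine (R.norm_lift_le μ (ν t).2 fun f => R.sigma_le μ fun ρ => ?_).trans
    (NNReal.coe_le_coe.2 (hM ⟨t, ht, rfl⟩))
  rw [normAt, CovRep.integrated_iGfun]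
  exact norm_mul_le_of_le ((h _ ρ.2).2 t) (R.normAt_le_sigma μ f ρ)

lemma dense_span_range_q : Dense (Submodule.span 𝕜 (Set.range (R.q μ)) : Set (R.CP μ)) :=
  (R.denseRange_q μ).mono Submodule.subset_span

lemma tendsto_iA_apply {ι : Type*} {l : Filter ι} {e : ι → A} (he : IsBddApproxLeftId l e)
    (c : R.CP μ) : Tendsto (fun i => (R.iA μ (e i)).1 c) l (𝓝 c) := by
  obtain ⟨M, hM⟩ := he.bounded
  obtain ⟨C, hC0, hC⟩ := R.exists_norm_iA_le μ
  have hbdd : ∀ᶠ i in l, ‖(R.iA μ (e i)).1‖ ≤ C * M :=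
    hM.mono fun i hi => (hC (e i)).trans (by gcongr)
  have hmul : ∀ᶠ i in l, ‖ContinuousLinearMap.mul 𝕜 A (e i)‖ ≤ M :=
    hM.mono fun i hi => (ContinuousLinearMap.opNorm_mul_apply_le 𝕜 A (e i)).trans hi
  refine tendsto_apply_of_dense_span (S₀ := ContinuousLinearMap.id 𝕜 (R.CP μ)) hbdd
    (R.dense_span_range_q μ) ?_ c
  rintro _ ⟨f, rfl⟩
  have hunif := (tendstoUniformlyOn_of_isCompact (S₀ := ContinuousLinearMap.id 𝕜 A) hmul
    he.tendsto_mul (f.hasCompactSupport.isCompact_range f.continuous)).comp f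
  have hzero : ∀ s ∉ tsupport f, f s = 0 := fun s => image_eq_zero_of_notMem_tsupport
  simp only [iA_q, ContinuousLinearMap.id_apply]
  refine R.tendsto_q_of_tendstoUniformlyOn μ f.hasCompactSupport
    (Eventually.of_forall fun i s hs => ?_) hzero (hunif.mono fun s _ => ⟨s, rfl⟩)
  rw [iAfun_apply, hzero s hs, mul_zero]

open scoped Pointwise in
lemma continuous_q_iGfun (f : C_c(G, A)) : Continuous fun r => R.q μ (iGfun D r f) := by
  refine continuous_iff_continuousAt.2 fun r => ?_
  obtain ⟨N, hN, hNr⟩ := exists_compact_mem_nhds r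
  have hK : IsCompact (N * tsupport f) := hN.mul f.hasCompactSupport
  have hzero : ∀ t ∈ N, ∀ s ∉ N * tsupport f, iGfun D t f s = 0 := fun t ht s hs => by
    have hts : t⁻¹ * s ∉ tsupport f := fun h => hs ⟨t, ht, t⁻¹ * s, h, mul_inv_cancel_left t s⟩
    rw [iGfun_apply, image_eq_zero_of_notMem_tsupport hts, map_zero]
  have hcont : Continuous fun p : G × G => D.act p.1 (f (p.1⁻¹ * p.2)) :=
    D.continuous_uncurry.comp (f := fun p : G × G => (p.1, f (p.1⁻¹ * p.2))) (by fun_prop)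
  exact R.tendsto_q_of_tendstoUniformlyOn μ hK (eventually_of_mem hNr hzero)
    (hzero r (mem_of_mem_nhds hNr))
    (ContinuousMap.tendsto_iff_forall_isCompact_tendstoUniformlyOn.1
      ((ContinuousMap.curry ⟨_, hcont⟩).continuous.tendsto r) _ hK)

lemma continuous_iG_apply (c : R.CP μ) : Continuous fun r => (R.iG μ r).1 c := by
  refine continuous_apply_of_dense_span (𝕜 := 𝕜) (V := fun r => (R.iG μ r).1)
    (R.exists_norm_iG_le μ) (R.dense_span_range_q μ) ?_ c
  rintro _ ⟨f, rfl⟩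
  simp only [iG_q]
  exact R.continuous_q_iGfun μ f

lemma exists_norm_q_elemTensor_le :
    ∃ C : ℝ, 0 ≤ C ∧ ∀ᶠ z in bumpFilter μ, ∀ a, ‖R.q μ (elemTensor 𝕜 z a)‖ ≤ C * ‖a‖ := by
  obtain ⟨K, hK, hK1⟩ := exists_compact_mem_nhds (1 : G)
  obtain ⟨C, hC0, hC⟩ := R.exists_sigma_le_integral μ hK
  refine ⟨C, hC0, ?_⟩
  filter_upwards [(hasBasis_bumpFilter μ).mem_of_mem hK1] with z ⟨hzK, hz0, hz1⟩ a
  have hzero : ∀ s ∉ K, elemTensor 𝕜 z a s = 0 := fun s hs => by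
    rw [elemTensor_apply, image_eq_zero_of_notMem_tsupport fun h => hs (hzK h), RCLike.ofReal_zero,
      zero_smul]
  have hnorm : ∀ s, ‖elemTensor 𝕜 z a s‖ = z s * ‖a‖ := fun s => by
    rw [elemTensor_apply, norm_smul, RCLike.norm_of_nonneg (hz0 s)]
  calc ‖R.q μ (elemTensor 𝕜 z a)‖ = R.sigma μ (elemTensor 𝕜 z a) := R.norm_q μ _
    _ ≤ C * ∫ s, ‖elemTensor 𝕜 z a s‖ ∂μ := hC _ hzero
    _ = C * ‖a‖ := by simp only [hnorm, integral_mul_const, hz1, one_mul]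

end RepClass

end System

/-! ### Integrated forms -/

section System

variable {𝕜 A G : Type*} [RCLike 𝕜] [NonUnitalNormedRing A] [NormedSpace 𝕜 A]
  [Group G] [TopologicalSpace G] {D : DynSys 𝕜 A G} {X : Type*}
  [NormedAddCommGroup X] [NormedSpace 𝕜 X]

lemma CovRep.ext_apply {ρ τ : CovRep D X} (hpi : ∀ a, ρ.pi a = τ.pi a)
    (hU : ∀ s, ρ.U s = τ.U s) : ρ = τ := by
  cases ρ
  cases τ
  congr
  · exact NonUnitalAlgHom.ext hpi
  · exact MonoidHom.ext hU

variable [IsTopologicalGroup G] [LocallyCompactSpace G] [CompleteSpace A] [MeasurableSpace G]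
  [BorelSpace G]

lemma CovRep.Intertwines.integrated_apply [CompleteSpace X] {Y : Type*} [NormedAddCommGroup Y]
    [NormedSpace 𝕜 Y] [CompleteSpace Y] {ρ : CovRep D X} {τ : CovRep D Y} {Φ : X →L[𝕜] Y}
    (hΦ : ρ.Intertwines τ Φ) (hρ : ρ.IsContinuous) (hτ : τ.IsContinuous) (μ : Measure G)
    [IsFiniteMeasureOnCompacts μ] (f : C_c(G, A)) (x : X) :
    Φ (ρ.integrated hρ μ f x) = τ.integrated hτ μ f (Φ x) := by
  have hpi : ∀ a y, τ.pi a (Φ y) = Φ (ρ.pi a y) := fun a => DFunLike.congr_fun (hΦ.1 a)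
  have hU : ∀ s y, τ.U s (Φ y) = Φ (ρ.U s y) := fun s => DFunLike.congr_fun (hΦ.2 s)
  simp only [CovRep.integrated_apply, ← vint_clm 𝕜 μ Φ (ρ.integrable_integrand hρ μ f x), hU, hpi]

namespace RepClass

variable [IsScalarTower 𝕜 A A] [SMulCommClass 𝕜 A A] (R : RepClass.{v} D)
  (μ : Measure G) [μ.IsHaarMeasure]

/-- The covariant representation `(i_A, i_G)` of the system on the crossed product itself. -/
def leftRegular : CovRep D (R.CP μ) := R.ofCentralizers μ (leftCentralizers 𝕜 (R.CP μ)).val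

lemma isContinuous_leftRegular : (R.leftRegular μ).IsContinuous :=
  ⟨(R.exists_norm_iA_le μ).imp fun _ h => h.2, R.continuous_iG_apply μ⟩

variable {R μ}

lemma intertwines_orbit {ρ : CovRep D X} {T : R.CP μ →ₙₐ[𝕜] (X →L[𝕜] X)} (hT : IsBddRep T)
    (hpi : ∀ a c x, ρ.pi a (T c x) = T ((R.iA μ a).1 c) x)
    (hU : ∀ s c x, ρ.U s (T c x) = T ((R.iG μ s).1 c) x) (x : X) :
    (R.leftRegular μ).Intertwines ρ (hT.orbit x) :=
  ⟨fun a => ContinuousLinearMap.ext fun c => hpi a c x,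
    fun s => ContinuousLinearMap.ext fun c => hU s c x⟩

variable [CompleteSpace X]

variable (R μ) in
/-- The bounded representation `T` of the crossed product is the integrated form `(π ⋊ U)^R` of the
continuous covariant representation `ρ = (π, U)`. As a relation between `ρ` and `T` it can be used
both to integrate `ρ` and to separate `T`. -/
structure IsIntegratedForm (ρ : CovRep D X) (T : R.CP μ →ₙₐ[𝕜] (X →L[𝕜] X)) : Prop where
  isContinuous : ρ.IsContinuous
  isBddRep : IsBddRep T
  apply_q : ∀ f, T (R.q μ f) = ρ.integrated isContinuous μ f

variable (R μ) in
lemma isIntegratedForm_integratedRep (ρ : CovRep D X) (h : R.IsRContinuous μ ρ) :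
    R.IsIntegratedForm μ ρ (R.integratedRep μ ρ h) :=
  ⟨h.1, ⟨_, (R.extCP μ (ρ.integrated h.1 μ) h.2).le_opNorm⟩, R.integratedRep_q μ ρ h⟩

namespace IsIntegratedForm

variable {ρ ρ' : CovRep D X} {T T' : R.CP μ →ₙₐ[𝕜] (X →L[𝕜] X)}

lemma isRContinuous (h : R.IsIntegratedForm μ ρ T) : R.IsRContinuous μ ρ :=
  ⟨h.isContinuous, ‖h.isBddRep.toCLM‖, fun f => by
    rw [← h.apply_q, ← norm_q]
    exact h.isBddRep.norm_apply_le _⟩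

lemma pi_apply (h : R.IsIntegratedForm μ ρ T) (a : A) (c : R.CP μ) (x : X) :
    ρ.pi a (T c x) = T ((R.iA μ a).1 c) x := by
  refine R.CP_induction μ (P := fun c => (ρ.pi a).comp (h.isBddRep.orbit x) c =
    (h.isBddRep.orbit x).comp (R.iA μ a).1 c) (isClosed_eq (by fun_prop) (by fun_prop))
    (fun f => ?_) c
  simp only [ContinuousLinearMap.comp_apply, IsBddRep.orbit_apply, iA_q, h.apply_q,
    CovRep.integrated_iAfun, mul_apply_eq_comp]

lemma U_apply (h : R.IsIntegratedForm μ ρ T) (s : G) (c : R.CP μ) (x : X) :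
    ρ.U s (T c x) = T ((R.iG μ s).1 c) x := by
  refine R.CP_induction μ (P := fun c => (ρ.U s).comp (h.isBddRep.orbit x) c =
    (h.isBddRep.orbit x).comp (R.iG μ s).1 c) (isClosed_eq (by fun_prop) (by fun_prop))
    (fun f => ?_) c
  simp only [ContinuousLinearMap.comp_apply, IsBddRep.orbit_apply, iG_q, h.apply_q,
    CovRep.integrated_iGfun, mul_apply_eq_comp]

lemma rep_unique (h : R.IsIntegratedForm μ ρ T) (h' : R.IsIntegratedForm μ ρ T') : T = T' := by
  have hT : h.isBddRep.toCLM = h'.isBddRep.toCLM :=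
    R.CP_hom_ext μ fun f => (h.apply_q f).trans (h'.apply_q f).symm
  exact NonUnitalAlgHom.ext fun c => DFunLike.congr_fun hT c

lemma covRep_unique (h : R.IsIntegratedForm μ ρ T) (h' : R.IsIntegratedForm μ ρ' T)
    (hn : IsNondegRep T) : ρ = ρ' :=
  CovRep.ext_apply (fun a => hn.ext_clm fun c x => by rw [h.pi_apply, h'.pi_apply])
    fun s => hn.ext_clm fun c x => by rw [h.U_apply, h'.U_apply]

end IsIntegratedForm

lemma norm_apply_le_of_mem {ρ : Σ X : BanachSp.{_, v} 𝕜, CovRep D X} (hρ : ρ ∈ R.carrier)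
    {T : R.CP μ →ₙₐ[𝕜] (ρ.1 →L[𝕜] ρ.1)} (h : R.IsIntegratedForm μ ρ.2 T) (c : R.CP μ) :
    ‖T c‖ ≤ ‖c‖ := by
  refine R.CP_induction μ (isClosed_le h.isBddRep.toCLM.continuous.norm continuous_norm)
    (fun f => ?_) c
  change ‖T (R.q μ f)‖ ≤ ‖R.q μ f‖
  rw [h.apply_q, norm_q]
  exact R.normAt_le_sigma μ f ⟨ρ, hρ⟩

lemma isRContinuous_of_mem {ρ : Σ X : BanachSp.{_, v} 𝕜, CovRep D X} (hρ : ρ ∈ R.carrier) :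
    R.IsRContinuous μ ρ.2 :=
  ⟨R.isContinuous ρ hρ, 1, fun f => by rw [one_mul]; exact R.normAt_le_sigma μ f ⟨ρ, hρ⟩⟩

lemma CP_eq_of_forall_isIntegratedForm {a b : R.CP μ}
    (h : ∀ ρ ∈ R.carrier, ∀ T, R.IsIntegratedForm μ ρ.2 T → T a = T b) : a = b := by
  suffices ∀ d : R.CP μ, ‖d‖ ≤ ‖a - b - d‖ by
    simpa only [sub_self, norm_zero, norm_le_zero_iff, sub_eq_zero] using this (a - b)
  refine R.CP_induction μ (isClosed_le (by fun_prop) (by fun_prop)) fun f => ?_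
  rw [norm_q]
  refine R.sigma_le μ fun ρ => ?_
  have hρ := R.isIntegratedForm_integratedRep μ ρ.1.2 (isRContinuous_of_mem ρ.2)
  calc ‖ρ.1.2.integrated _ μ f‖ = ‖R.integratedRep μ ρ.1.2 _ (a - b - R.q μ f)‖ := by
        rw [map_sub, map_sub, h _ ρ.2 _ hρ, sub_self, zero_sub, norm_neg, hρ.apply_q]
    _ ≤ ‖a - b - R.q μ f‖ := norm_apply_le_of_mem ρ.2 hρ _

lemma IsIntegratedForm.intertwines_orbit {ρ : CovRep D X} {T : R.CP μ →ₙₐ[𝕜] (X →L[𝕜] X)}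
    (h : R.IsIntegratedForm μ ρ T) (x : X) :
    (R.leftRegular μ).Intertwines ρ (h.isBddRep.orbit x) :=
  RepClass.intertwines_orbit h.isBddRep h.pi_apply h.U_apply x

lemma integrated_leftRegular_apply (f : C_c(G, A)) (c : R.CP μ) :
    (R.leftRegular μ).integrated (R.isContinuous_leftRegular μ) μ f c = R.q μ f * c := by
  refine CP_eq_of_forall_isIntegratedForm fun ρ _ T h => ContinuousLinearMap.ext fun x => ?_
  calc T ((R.leftRegular μ).integrated _ μ f c) x = ρ.2.integrated h.isContinuous μ f (T c x) :=
        (h.intertwines_orbit x).integrated_apply _ _ μ f c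
    _ = T (R.q μ f * c) x := by rw [rep_mul_apply, h.apply_q]

lemma isBddApproxLeftId_q_elemTensor {ι : Type*} {l : Filter ι} {e : ι → A}
    (he : IsBddApproxLeftId l e) :
    IsBddApproxLeftId (l ×ˢ bumpFilter μ) fun p => R.q μ (elemTensor 𝕜 p.2 (e p.1)) := by
  obtain ⟨M, hM⟩ := he.bounded
  obtain ⟨C, hC0, hC⟩ := R.exists_norm_q_elemTensor_le μ
  obtain ⟨C', hC'0, hC'⟩ := R.exists_norm_iA_le μ
  refine ⟨⟨C * M, (hM.prod_mk hC).mono fun p hp => (hp.2 _).trans ?_⟩, fun c => ?_⟩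
  · gcongr
    exact hp.1
  · have hbdd : ∀ᶠ p in l ×ˢ bumpFilter μ, ‖(R.iA μ (e p.1)).1‖ ≤ C' * M :=
      tendsto_fst.eventually (hM.mono fun i hi => (hC' (e i)).trans (by gcongr))
    have hbump : Tendsto (fun z : C_c(G, ℝ) => vint 𝕜 μ fun s => (z s : 𝕜) • (R.iG μ s).1 c)
        (bumpFilter μ) (𝓝 c) := by
      simpa only [map_one, OneMemClass.coe_one, one_apply_eq_self] using
        tendsto_vint_smul (R.continuous_iG_apply μ c)
    simp only [← integrated_leftRegular_apply, CovRep.integrated_elemTensor]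
    exact tendsto_apply_apply hbdd ((R.tendsto_iA_apply μ he c).comp tendsto_fst)
      (hbump.comp tendsto_snd)

end RepClass

end System

/-! ### Separation of a representation -/

lemma vint_mem {𝕜 E Ω : Type*} [RCLike 𝕜] [NormedAddCommGroup E] [NormedSpace 𝕜 E]
    [CompleteSpace E] [MeasurableSpace Ω] {μ : Measure Ω} {Z : Submodule 𝕜 E}
    (hZ : IsClosed (Z : Set E)) {f : Ω → E} (hf : Integrable f μ) (h : ∀ s, f s ∈ Z) :
    vint 𝕜 μ f ∈ Z := by
  have : IsClosed (Z : Set E) := hZ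
  refine (Submodule.Quotient.mk_eq_zero Z).1 ((vint_clm 𝕜 μ Z.mkQL hf).symm.trans ?_)
  exact vint_eq_zero 𝕜 μ fun s => (Submodule.Quotient.mk_eq_zero Z).2 (h s)

section System

variable {𝕜 A G : Type*} [RCLike 𝕜] [NonUnitalNormedRing A] [NormedSpace 𝕜 A]
  [IsScalarTower 𝕜 A A] [SMulCommClass 𝕜 A A] [CompleteSpace A] [Group G] [TopologicalSpace G]
  [IsTopologicalGroup G] [LocallyCompactSpace G] [MeasurableSpace G] [BorelSpace G]
  {D : DynSys 𝕜 A G} {X : Type*} [NormedAddCommGroup X] [NormedSpace 𝕜 X]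

namespace RepClass

variable {R : RepClass.{v} D} {μ : Measure G} [μ.IsHaarMeasure]
  {T : R.CP μ →ₙₐ[𝕜] (X →L[𝕜] X)}

lemma separatedRep_eq_ofCentralizers (hn : IsNondegRep T)
    {Tbar : leftCentralizers 𝕜 (R.CP μ) →ₐ[𝕜] (X →L[𝕜] X)}
    (h : R.Extends μ (Tbar : leftCentralizers 𝕜 (R.CP μ) →ₙₐ[𝕜] (X →L[𝕜] X)) T) :
    R.separatedRep μ T = R.ofCentralizers μ Tbar := by
  have hex : ∃ Tbar : leftCentralizers 𝕜 (R.CP μ) →ₐ[𝕜] (X →L[𝕜] X),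
      R.Extends μ (Tbar : leftCentralizers 𝕜 (R.CP μ) →ₙₐ[𝕜] (X →L[𝕜] X)) T := ⟨Tbar, h⟩
  rw [separatedRep, dif_pos hex]
  congr 1
  exact AlgHom.ext (hn.extension_unique hex.choose_spec h)

variable [CompleteSpace X]

lemma isIntegratedForm_of_apply {ρ : CovRep D X} (hρ : ρ.IsContinuous) (hT : IsBddRep T)
    (hn : IsNondegRep T) (hpi : ∀ a c x, ρ.pi a (T c x) = T ((R.iA μ a).1 c) x)
    (hU : ∀ s c x, ρ.U s (T c x) = T ((R.iG μ s).1 c) x) : R.IsIntegratedForm μ ρ T := by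
  refine ⟨hρ, hT, fun f => hn.ext_clm fun c x => ?_⟩
  calc T (R.q μ f) (T c x)
      = T ((R.leftRegular μ).integrated (R.isContinuous_leftRegular μ) μ f c) x := by
        rw [integrated_leftRegular_apply, rep_mul_apply]
    _ = ρ.integrated hρ μ f (T c x) :=
        (intertwines_orbit hT hpi hU x).integrated_apply _ _ μ f c

lemma isIntegratedForm_ofCentralizers (hT : IsBddRep T) (hn : IsNondegRep T)
    {Tbar : leftCentralizers 𝕜 (R.CP μ) →ₐ[𝕜] (X →L[𝕜] X)}
    (hTbar : ∀ c, Tbar (leftMul 𝕜 c) = T c) {C : ℝ} (hC : ∀ L, ‖Tbar L‖ ≤ C * ‖L‖) :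
    R.IsIntegratedForm μ (R.ofCentralizers μ Tbar) T := by
  have happly : ∀ L c x, Tbar L (T c x) = T (L.1 c) x :=
    extension_apply (T' := (Tbar : leftCentralizers 𝕜 (R.CP μ) →ₙₐ[𝕜] (X →L[𝕜] X))) hTbar
  have hbound : ∀ {L : leftCentralizers 𝕜 (R.CP μ)} {M : ℝ}, ‖L‖ ≤ M → ‖Tbar L‖ ≤ |C| * M :=
    fun {L M} hL => (hC L).trans (mul_le_mul (le_abs_self C) hL (norm_nonneg _) (abs_nonneg C))
  obtain ⟨C', -, hC'⟩ := R.exists_norm_iA_le μ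
  have hU : ∀ s c x, (R.ofCentralizers μ Tbar).U s (T c x) = T ((R.iG μ s).1 c) x :=
    fun s => happly (R.iG μ s)
  refine isIntegratedForm_of_apply ⟨⟨|C| * C', fun a => ?_⟩, continuous_apply_of_dense_span
    (fun r => ?_) hn ?_⟩ hT hn (fun a => happly (R.iA μ a)) hU
  · rw [mul_assoc]
    exact hbound (hC' a)
  · obtain ⟨M, hM⟩ := R.exists_norm_iG_le μ r
    exact ⟨|C| * M, hM.mono fun t ht => hbound ht⟩
  · rintro _ ⟨c, x, rfl⟩
    simp only [hU]
    exact (hT.orbit x).continuous.comp (R.continuous_iG_apply μ c)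

section Net

variable {ι : Type*} {l : Filter ι} [l.NeBot] {e : ι → R.CP μ}

lemma exists_separatedRep_eq_ofCentralizers (he : IsBddApproxLeftId l e) (hT : IsBddRep T)
    (hn : IsNondegRep T) :
    ∃ Tbar : leftCentralizers 𝕜 (R.CP μ) →ₐ[𝕜] (X →L[𝕜] X),
      R.Extends μ (Tbar : leftCentralizers 𝕜 (R.CP μ) →ₙₐ[𝕜] (X →L[𝕜] X)) T ∧
      (∀ T' : leftCentralizers 𝕜 (R.CP μ) →ₙₐ[𝕜] (X →L[𝕜] X),
        R.Extends μ T' T → ∀ L, T' L = Tbar L) ∧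
      (∃ C : ℝ, ∀ L, ‖Tbar L‖ ≤ C * ‖L‖) ∧ R.separatedRep μ T = R.ofCentralizers μ Tbar := by
  obtain ⟨Tbar, hTbar, hC⟩ := he.exists_extension hT hn
  exact ⟨Tbar, hTbar, fun T' hT' => hn.extension_unique (T'' := ↑Tbar) hT' hTbar, hC,
    separatedRep_eq_ofCentralizers hn hTbar⟩

lemma isIntegratedForm_separatedRep (he : IsBddApproxLeftId l e) (hT : IsBddRep T)
    (hn : IsNondegRep T) : R.IsIntegratedForm μ (R.separatedRep μ T) T := by
  obtain ⟨Tbar, hTbar, -, ⟨C, hC⟩, hsep⟩ := exists_separatedRep_eq_ofCentralizers he hT hn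
  rw [hsep]
  exact isIntegratedForm_ofCentralizers hT hn hTbar hC

end Net

lemma isIntegratedForm_integration {ρ : Σ X : BanachSp.{_, w} 𝕜, CovRep D X}
    (h : R.IsRContinuous μ ρ.2) : R.IsIntegratedForm μ ρ.2 (R.integration μ ρ).2 := by
  have hT : (R.integration μ ρ).2 = R.integratedRep μ ρ.2 h := dif_pos h
  rw [hT]
  exact R.isIntegratedForm_integratedRep μ ρ.2 h

/-! ### Transfer of properties along the integrated form -/

namespace IsIntegratedForm

variable {ρ : CovRep D X}

lemma isNondegRep (h : R.IsIntegratedForm μ ρ T) (hn : ρ.IsNondeg) : IsNondegRep T := by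
  refine dense_span_of_subset_closure hn ?_
  rintro _ ⟨a, x, rfl⟩
  have hx : Tendsto (fun z : C_c(G, ℝ) => vint 𝕜 μ fun s => (z s : 𝕜) • ρ.U s x)
      (bumpFilter μ) (𝓝 x) := by
    simpa only [map_one, one_apply_eq_self] using tendsto_vint_smul (h.isContinuous.2 x)
  refine mem_closure_of_tendsto (((ρ.pi a).continuous.tendsto x).comp hx)
    (Eventually.of_forall fun z => Submodule.subset_span ⟨R.q μ (elemTensor 𝕜 z a), x, ?_⟩)
  rw [h.apply_q, CovRep.integrated_elemTensor, Function.comp_apply]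

lemma isNondeg {ι : Type*} {l : Filter ι} [l.NeBot] {e : ι → A} (he : IsBddApproxLeftId l e)
    (h : R.IsIntegratedForm μ ρ T) (hn : IsNondegRep T) : ρ.IsNondeg := by
  refine dense_span_of_subset_closure hn ?_
  rintro _ ⟨c, x, rfl⟩
  refine mem_closure_of_tendsto
    (((h.isBddRep.orbit x).continuous.tendsto c).comp (R.tendsto_iA_apply μ he c))
    (Eventually.of_forall fun i => Submodule.subset_span ⟨e i, T c x, ?_⟩)
  exact (h.pi_apply (e i) c x).symm

lemma isInvariant_of_isInvariantRep {ι : Type*} {l : Filter ι} [l.NeBot] {e : ι → R.CP μ}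
    (he : IsBddApproxLeftId l e) (h : R.IsIntegratedForm μ ρ T) (hn : IsNondegRep T)
    {Z : Submodule 𝕜 X} (hZ : IsClosed (Z : Set X)) (hTZ : IsInvariantRep T Z) :
    ρ.IsInvariant Z := by
  have hlim : ∀ S : X →L[𝕜] X, (∀ c, ∀ x ∈ Z, S (T c x) ∈ Z) → ∀ x ∈ Z, S x ∈ Z :=
    fun S hS x hx => hZ.mem_of_tendsto ((S.continuous.tendsto x).comp
      (he.tendsto_rep h.isBddRep hn x)) (Eventually.of_forall fun i => hS (e i) x hx)
  exact ⟨fun a => hlim _ fun c x hx => h.pi_apply a c x ▸ hTZ _ x hx,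
    fun s => hlim _ fun c x hx => h.U_apply s c x ▸ hTZ _ x hx⟩

lemma isInvariantRep_of_isInvariant (h : R.IsIntegratedForm μ ρ T) {Z : Submodule 𝕜 X}
    (hZ : IsClosed (Z : Set X)) (hρZ : ρ.IsInvariant Z) : IsInvariantRep T Z := by
  intro c x hx
  refine R.CP_induction μ (P := fun c => T c x ∈ Z)
    (hZ.preimage (h.isBddRep.orbit x).continuous) (fun f => ?_) c
  rw [h.apply_q, CovRep.integrated_apply]
  exact vint_mem hZ (ρ.integrable_integrand h.isContinuous μ f x)
    fun s => hρZ.1 _ _ (hρZ.2 s x hx)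

lemma isInvariantRep_iff {ι : Type*} {l : Filter ι} [l.NeBot] {e : ι → R.CP μ}
    (he : IsBddApproxLeftId l e) (h : R.IsIntegratedForm μ ρ T) (hn : IsNondegRep T)
    {Z : Submodule 𝕜 X} (hZ : IsClosed (Z : Set X)) : IsInvariantRep T Z ↔ ρ.IsInvariant Z :=
  ⟨h.isInvariant_of_isInvariantRep he hn hZ, h.isInvariantRep_of_isInvariant hZ⟩

lemma intertwinesRep_iff {Y : Type*} [NormedAddCommGroup Y] [NormedSpace 𝕜 Y] [CompleteSpace Y]
    {τ : CovRep D Y} {S : R.CP μ →ₙₐ[𝕜] (Y →L[𝕜] Y)} (h : R.IsIntegratedForm μ ρ T)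
    (h' : R.IsIntegratedForm μ τ S) (hn : IsNondegRep T) {Φ : X →L[𝕜] Y} :
    IntertwinesRep T S Φ ↔ ρ.Intertwines τ Φ := by
  constructor
  · intro hΦ
    have hΦ' : ∀ c x, Φ (T c x) = S c (Φ x) := fun c x => (DFunLike.congr_fun (hΦ c) x).symm
    exact ⟨fun a => hn.ext_clm fun c x => by
        simp only [ContinuousLinearMap.comp_apply, hΦ', h.pi_apply, h'.pi_apply],
      fun s => hn.ext_clm fun c x => by
        simp only [ContinuousLinearMap.comp_apply, hΦ', h.U_apply, h'.U_apply]⟩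
  · refine fun hΦ c => ContinuousLinearMap.ext fun x => ?_
    have hext : h'.isBddRep.orbit (Φ x) = Φ.comp (h.isBddRep.orbit x) := R.CP_hom_ext μ fun f => by
      simp only [IsBddRep.orbit_apply, ContinuousLinearMap.comp_apply, h.apply_q, h'.apply_q,
        hΦ.integrated_apply h.isContinuous h'.isContinuous]
    exact DFunLike.congr_fun hext c

end IsIntegratedForm

end RepClass

end System

/-! ### The involutive case -/

section HilbertCore

variable {𝕜 B X : Type*} [RCLike 𝕜] [NonUnitalNormedRing B] [NormedSpace 𝕜 B]
  [NormedAddCommGroup X] [NormedSpace 𝕜 X] {c : InnerProductSpace.Core 𝕜 X}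

/-- The inner product space structure given by a core that is compatible with the norm. It gives
access to the library of inner product spaces, with the norm and scalar multiplication of `X`
unchanged. -/
abbrev IsHilbertCore.innerProductSpace (hc : IsHilbertCore c) : InnerProductSpace 𝕜 X :=
  { (inferInstance : NormedSpace 𝕜 X), c with
    norm_sq_eq_re_inner := fun x => (hc x).symm
    conj_inner_symm := c.conj_inner_symm
    add_left := c.add_left
    smul_left := c.smul_left }

lemma IsHilbertCore.continuous_inner (hc : IsHilbertCore c) :
    Continuous fun p : X × X => c.inner p.1 p.2 := by
  let := hc.innerProductSpace
  exact _root_.continuous_inner (𝕜 := 𝕜) (E := X)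

lemma IsNondegRep.inner_ext {T : B →ₙₐ[𝕜] (X →L[𝕜] X)} (hn : IsNondegRep T)
    (hc : IsHilbertCore c) {S S' P P' : X →L[𝕜] X}
    (h : ∀ a b x y, c.inner (S (T a x)) (P (T b y)) = c.inner (S' (T a x)) (P' (T b y)))
    (x y : X) : c.inner (S x) (P y) = c.inner (S' x) (P' y) := by
  let := hc.innerProductSpace
  have hright : ∀ a x y, inner 𝕜 (S (T a x)) (P y) = inner 𝕜 (S' (T a x)) (P' y) :=
    fun a x y => DFunLike.congr_fun (hn.ext_clm (S := (innerSL 𝕜 (S (T a x))).comp P)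
      (S' := (innerSL 𝕜 (S' (T a x))).comp P') fun b y => h a b x y) y
  have hleft : (innerSL 𝕜 (P y)).comp S = (innerSL 𝕜 (P' y)).comp S' := hn.ext_clm fun a x => by
    simp only [ContinuousLinearMap.comp_apply, innerSL_apply_apply]
    rw [← inner_conj_symm, hright, inner_conj_symm]
  have hconj := congr_arg (starRingEnd 𝕜) (DFunLike.congr_fun hleft x)
  simp only [ContinuousLinearMap.comp_apply, innerSL_apply_apply, inner_conj_symm] at hconj
  exact hconj

end HilbertCore

section Involutive

variable {𝕜 A G : Type*} [RCLike 𝕜] [NonUnitalNormedRing A] [NormedSpace 𝕜 A]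
  [Group G] [TopologicalSpace G]

lemma DynSys.act_mul_apply (D : DynSys 𝕜 A G) (s t : G) (a : A) :
    D.act (s * t) a = D.act s (D.act t a) := by
  rw [map_mul, mul_apply_eq_comp]

variable [IsTopologicalGroup G] [LocallyCompactSpace G] [CompleteSpace A] [MeasurableSpace G]
  [BorelSpace G] {D : DynSys 𝕜 A G} (μ : Measure G) [μ.IsHaarMeasure]

lemma DynSys.conv_apply (f g : C_c(G, A)) (s : G) :
    D.conv μ f g s = vint 𝕜 μ fun r => f r * D.act r (g (r⁻¹ * s)) := rfl

variable [StarRing A] [StarModule 𝕜 A] (hD : D.IsInvolutive) [IsScalarTower 𝕜 A A]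

/-- The substitution `s ↦ s⁻¹` absorbs the modular function of the involution. -/
lemma DynSys.conv_invol_apply (f g : C_c(G, A)) (t : G) :
    D.conv μ (D.invol hD f) g t = vint 𝕜 μ fun s => D.act s⁻¹ (star (f s) * g (s * t)) := by
  have hcont : Continuous fun s => D.act s⁻¹ (star (f s) * g (s * t)) :=
    D.continuous_uncurry.comp (f := fun s => (s⁻¹, star (f s) * g (s * t)))
      (continuous_inv.prodMk ((hD.continuous_star.comp f.continuous).mul (by fun_prop)))
  have hsupp : HasCompactSupport fun s => D.act s⁻¹ (star (f s) * g (s * t)) :=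
    f.hasCompactSupport.mono fun s hs hf => hs (by simp only [hf, star_zero, zero_mul, map_zero])
  rw [← vint_modular_inv μ 𝕜 hcont hsupp]
  simp only [DynSys.conv_apply, DynSys.invol_apply, smul_mul_assoc, inv_inv, D.act_mul]

lemma DynSys.conv_invol_iGfun (r : G) (f g : C_c(G, A)) :
    D.conv μ (D.invol hD (iGfun D r f)) (iGfun D r g) = D.conv μ (D.invol hD f) g := by
  ext t
  have htranslate : ∀ (h : C_c(G, A)) s, iGfun D r h s = D.act r (h (r⁻¹ * s)) := fun _ _ => rfl
  have hcancel : ∀ s a, D.act (s⁻¹ * r) a = D.act (r⁻¹ * s)⁻¹ a := fun s a => by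
    rw [mul_inv_rev, inv_inv]
  simp only [DynSys.conv_invol_apply, htranslate, ← hD.act_star, ← D.act_mul,
    ← DynSys.act_mul_apply, ← mul_assoc, hcancel]
  exact vint_mul_left 𝕜 μ (f := fun s => D.act s⁻¹ (star (f s) * g (s * t))) r⁻¹

variable [SMulCommClass 𝕜 A A]

lemma DynSys.conv_invol_iAfun (a : A) (f g : C_c(G, A)) :
    D.conv μ (D.invol hD (iAfun 𝕜 (star a) f)) g = D.conv μ (D.invol hD f) (iAfun 𝕜 a g) := by
  ext s
  simp only [DynSys.conv_apply, DynSys.invol_apply, iAfun_apply, star_mul, star_star, D.act_mul,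
    smul_mul_assoc, mul_assoc]

namespace RepClass

variable {R : RepClass.{v} D} (hR : R.IsInvolutive)
include hR

lemma cpStar_iA_mul (a : A) (b c : R.CP μ) :
    R.cpStar μ hD ((R.iA μ (star a)).1 b) * c = R.cpStar μ hD b * (R.iA μ a).1 c := by
  have hstar := R.continuous_cpStar μ hD
  refine (R.denseRange_q μ).induction_on₂ (isClosed_eq (by fun_prop) (by fun_prop))
    (fun f g => ?_) b c
  simp only [iA_q, cpStar_q _ _ _ hR, q_mul_q, DynSys.conv_invol_iAfun]

lemma cpStar_iG_mul (r : G) (b c : R.CP μ) :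
    R.cpStar μ hD ((R.iG μ r).1 b) * (R.iG μ r).1 c = R.cpStar μ hD b * c := by
  have hstar := R.continuous_cpStar μ hD
  refine (R.denseRange_q μ).induction_on₂ (isClosed_eq (by fun_prop) (by fun_prop))
    (fun f g => ?_) b c
  simp only [iG_q, cpStar_q _ _ _ hR, q_mul_q, DynSys.conv_invol_iGfun]

namespace IsIntegratedForm

variable {μ} {X : Type*} [NormedAddCommGroup X] [NormedSpace 𝕜 X] [CompleteSpace X]
  {ρ : CovRep D X} {T : R.CP μ →ₙₐ[𝕜] (X →L[𝕜] X)}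

lemma isInvolutiveRep (h : R.IsIntegratedForm μ ρ T) (hρ : ρ.IsInvolutive) :
    IsInvolutiveRep (R.cpStar μ hD) T := by
  obtain ⟨c, hc, hpi, hU⟩ := hρ
  refine ⟨c, hc, fun b x y => ?_⟩
  have hleft : Continuous fun b => c.inner (h.isBddRep.orbit x (R.cpStar μ hD b)) y :=
    hc.continuous_inner.comp ((h.isBddRep.orbit x).continuous.comp
      (R.continuous_cpStar μ hD) |>.prodMk continuous_const)
  have hright : Continuous fun b => c.inner x (h.isBddRep.orbit y b) :=
    hc.continuous_inner.comp (continuous_const.prodMk (h.isBddRep.orbit y).continuous)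
  refine R.CP_induction μ (isClosed_eq hleft hright) (fun f => ?_) b
  rw [cpStar_q _ _ _ hR, h.isBddRep.orbit_apply, h.isBddRep.orbit_apply, h.apply_q, h.apply_q]
  exact ρ.inner_integrated_invol hD h.isContinuous μ c hc hpi hU f x y

lemma isInvolutive (h : R.IsIntegratedForm μ ρ T) (hn : IsNondegRep T)
    (hT : IsInvolutiveRep (R.cpStar μ hD) T) : ρ.IsInvolutive := by
  obtain ⟨c, hc, hadj⟩ := hT
  have hadj' : ∀ b x y, c.inner (T b x) y = c.inner x (T (R.cpStar μ hD b) y) := fun b x y => by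
    rw [← c.conj_inner_symm, ← hadj, c.conj_inner_symm]
  refine ⟨c, hc, fun a => hn.inner_ext hc (P := .id 𝕜 X) (S' := .id 𝕜 X) fun b d x y => ?_,
    fun s => hn.inner_ext hc (S' := .id 𝕜 X) (P' := .id 𝕜 X) fun b d x y => ?_⟩
  · simp only [ContinuousLinearMap.id_apply, h.pi_apply, hadj', ← rep_mul_apply,
      cpStar_iA_mul μ hD hR]
  · simp only [ContinuousLinearMap.id_apply, h.U_apply, hadj', ← rep_mul_apply,
      cpStar_iG_mul μ hD hR]

end IsIntegratedForm

end RepClass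

end Involutive

end
end CrossedProd

theorem theoremt_general {𝕜 : Type u𝕜} {A : Type uA} {G : Type uG} [RCLike 𝕜]
    [NonUnitalNormedRing A] [NormedSpace 𝕜 A] [IsScalarTower 𝕜 A A] [SMulCommClass 𝕜 A A]
    [CompleteSpace A]
    [Group G] [TopologicalSpace G] [IsTopologicalGroup G] [LocallyCompactSpace G]
    [MeasurableSpace G] [BorelSpace G] (μ : Measure G) [μ.IsHaarMeasure]
    (D : DynSys 𝕜 A G) (hA : HasBoundedApproxLeftId A)
    (R : RepClass.{v} D) (𝓧 : Set (BanachSp.{u𝕜, w} 𝕜)) :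
    (∀ T ∈ R.repSet μ 𝓧,
      ∃ Tbar : leftCentralizers 𝕜 (R.CP μ) →ₐ[𝕜] (T.1 →L[𝕜] T.1),
        R.Extends μ (Tbar : leftCentralizers 𝕜 (R.CP μ) →ₙₐ[𝕜] (T.1 →L[𝕜] T.1)) T.2 ∧
        (∀ T' : leftCentralizers 𝕜 (R.CP μ) →ₙₐ[𝕜] (T.1 →L[𝕜] T.1),
          R.Extends μ T' T.2 → ∀ L, T' L = Tbar L) ∧
        (∃ C : ℝ, ∀ L, ‖Tbar L‖ ≤ C * ‖L‖) ∧
        R.separatedRep μ T.2 = R.ofCentralizers μ Tbar) ∧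
    Set.BijOn (R.integration μ) (R.covRepSet μ 𝓧) (R.repSet μ 𝓧) ∧
    Set.BijOn (R.separation μ) (R.repSet μ 𝓧) (R.covRepSet μ 𝓧) ∧
    Set.InvOn (R.separation μ) (R.integration μ) (R.covRepSet μ 𝓧) (R.repSet μ 𝓧) ∧
    (∀ ρ ∈ R.covRepSet μ 𝓧, ∀ Z : Submodule 𝕜 ρ.1, IsClosed (Z : Set ρ.1) →
      (IsInvariantRep (X := ρ.1) (R.integration μ ρ).2 Z ↔ ρ.2.IsInvariant Z)) ∧
    (∀ T ∈ R.repSet μ 𝓧, ∀ Z : Submodule 𝕜 T.1, IsClosed (Z : Set T.1) →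
      ((R.separatedRep μ T.2).IsInvariant Z ↔ IsInvariantRep T.2 Z)) ∧
    (∀ ρ ∈ R.covRepSet μ 𝓧, ∀ τ ∈ R.covRepSet μ 𝓧, ∀ Φ : ρ.1 →L[𝕜] τ.1,
      (IntertwinesRep (X := ρ.1) (Y := τ.1) (R.integration μ ρ).2 (R.integration μ τ).2 Φ ↔
        ρ.2.Intertwines τ.2 Φ)) ∧
    (∀ T ∈ R.repSet μ 𝓧, ∀ S ∈ R.repSet μ 𝓧, ∀ Φ : T.1 →L[𝕜] S.1,
      ((R.separatedRep μ T.2).Intertwines (R.separatedRep μ S.2) Φ ↔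
        IntertwinesRep T.2 S.2 Φ)) ∧
    (∀ [StarRing A] [StarModule 𝕜 A] (hD : D.IsInvolutive), R.IsInvolutive →
      (∀ ρ ∈ R.covRepSet μ 𝓧, ρ.2.IsInvolutive →
        IsInvolutiveRep (R.cpStar μ hD) (R.integration μ ρ).2) ∧
      (∀ T ∈ R.repSet μ 𝓧, IsInvolutiveRep (R.cpStar μ hD) T.2 →
        (R.separatedRep μ T.2).IsInvolutive)) := by
  obtain ⟨ι, l, e, hl, he⟩ := hA.exists_isBddApproxLeftId
  have hb := RepClass.isBddApproxLeftId_q_elemTensor (R := R) (μ := μ) he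
  have hI : ∀ ρ ∈ R.covRepSet μ 𝓧, R.IsIntegratedForm μ ρ.2 (R.integration μ ρ).2 :=
    fun ρ hρ => RepClass.isIntegratedForm_integration hρ.2.2
  have hS : ∀ T ∈ R.repSet μ 𝓧, R.IsIntegratedForm μ (R.separatedRep μ T.2) T.2 :=
    fun T hT => RepClass.isIntegratedForm_separatedRep hb hT.2.2 hT.2.1
  have hmapsI : Set.MapsTo (R.integration μ) (R.covRepSet μ 𝓧) (R.repSet μ 𝓧) :=
    fun ρ hρ => ⟨hρ.1, (hI ρ hρ).isNondegRep hρ.2.1, (hI ρ hρ).isBddRep⟩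
  have hmapsS : Set.MapsTo (R.separation μ) (R.repSet μ 𝓧) (R.covRepSet μ 𝓧) :=
    fun T hT => ⟨hT.1, (hS T hT).isNondeg he hT.2.1, (hS T hT).isRContinuous⟩
  have hinv : Set.InvOn (R.separation μ) (R.integration μ) (R.covRepSet μ 𝓧) (R.repSet μ 𝓧) :=
    ⟨fun ρ hρ => Sigma.ext rfl (heq_of_eq ((hS _ (hmapsI hρ)).covRep_unique (hI ρ hρ)
        (hmapsI hρ).2.1)),
      fun T hT => Sigma.ext rfl (heq_of_eq ((hI _ (hmapsS hT)).rep_unique (hS T hT)))⟩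
  refine ⟨fun T hT => RepClass.exists_separatedRep_eq_ofCentralizers hb hT.2.2 hT.2.1,
    hinv.bijOn hmapsI hmapsS, hinv.symm.bijOn hmapsS hmapsI, hinv,
    fun ρ hρ Z hZ => (hI ρ hρ).isInvariantRep_iff hb (hmapsI hρ).2.1 hZ,
    fun T hT Z hZ => ((hS T hT).isInvariantRep_iff hb hT.2.1 hZ).symm,
    fun ρ hρ τ hτ Φ => (hI ρ hρ).intertwinesRep_iff (hI τ hτ) (hmapsI hρ).2.1,
    fun T hT S hS' Φ => ((hS T hT).intertwinesRep_iff (hS S hS') hT.2.1).symm,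
    fun hD hR => ⟨fun ρ hρ => (hI ρ hρ).isInvolutiveRep hD hR,
      fun T hT => (hS T hT).isInvolutive hD hR hT.2.1⟩⟩

theorem theoremt {𝕜 : Type u𝕜} {A : Type uA} {G : Type uG} [RCLike 𝕜]
    [NonUnitalNormedRing A] [NormedSpace 𝕜 A] [IsScalarTower 𝕜 A A] [SMulCommClass 𝕜 A A]
    [CompleteSpace A]
    [Group G] [TopologicalSpace G] [IsTopologicalGroup G] [LocallyCompactSpace G] [T2Space G]
    [MeasurableSpace G] [BorelSpace G] (μ : Measure G) [μ.IsHaarMeasure] [μ.Regular]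
    (D : DynSys 𝕜 A G) (hA : HasBoundedApproxLeftId A)
    (R : RepClass.{v} D) (hR : ∀ ρ ∈ R.carrier, ρ.2.IsNondeg)
    (𝓧 : Set (BanachSp.{u𝕜, w} 𝕜)) (h𝓧 : 𝓧.Nonempty) :
    -- `separation` is well-defined: there is a unique `T̄`, it is bounded, and the image
    -- of `T` is `(T̄ ∘ i_A, T̄ ∘ i_G)`
    (∀ T ∈ R.repSet μ 𝓧,
      ∃ Tbar : leftCentralizers 𝕜 (R.CP μ) →ₐ[𝕜] (T.1 →L[𝕜] T.1),
        R.Extends μ (Tbar : leftCentralizers 𝕜 (R.CP μ) →ₙₐ[𝕜] (T.1 →L[𝕜] T.1)) T.2 ∧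
        (∀ T' : leftCentralizers 𝕜 (R.CP μ) →ₙₐ[𝕜] (T.1 →L[𝕜] T.1),
          R.Extends μ T' T.2 → ∀ L, T' L = Tbar L) ∧
        (∃ C : ℝ, ∀ L, ‖Tbar L‖ ≤ C * ‖L‖) ∧
        R.separatedRep μ T.2 = R.ofCentralizers μ Tbar) ∧
    -- the two bijections, inverse to each other
    Set.BijOn (R.integration μ) (R.covRepSet μ 𝓧) (R.repSet μ 𝓧) ∧
    Set.BijOn (R.separation μ) (R.repSet μ 𝓧) (R.covRepSet μ 𝓧) ∧
    Set.InvOn (R.separation μ) (R.integration μ) (R.covRepSet μ 𝓧) (R.repSet μ 𝓧) ∧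
    -- closed invariant subspaces
    (∀ ρ ∈ R.covRepSet μ 𝓧, ∀ Z : Submodule 𝕜 ρ.1, IsClosed (Z : Set ρ.1) →
      (IsInvariantRep (X := ρ.1) (R.integration μ ρ).2 Z ↔ ρ.2.IsInvariant Z)) ∧
    (∀ T ∈ R.repSet μ 𝓧, ∀ Z : Submodule 𝕜 T.1, IsClosed (Z : Set T.1) →
      ((R.separatedRep μ T.2).IsInvariant Z ↔ IsInvariantRep T.2 Z)) ∧
    -- bounded intertwining operators
    (∀ ρ ∈ R.covRepSet μ 𝓧, ∀ τ ∈ R.covRepSet μ 𝓧, ∀ Φ : ρ.1 →L[𝕜] τ.1,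
      (IntertwinesRep (X := ρ.1) (Y := τ.1) (R.integration μ ρ).2 (R.integration μ τ).2 Φ ↔
        ρ.2.Intertwines τ.2 Φ)) ∧
    (∀ T ∈ R.repSet μ 𝓧, ∀ S ∈ R.repSet μ 𝓧, ∀ Φ : T.1 →L[𝕜] S.1,
      ((R.separatedRep μ T.2).Intertwines (R.separatedRep μ S.2) Φ ↔
        IntertwinesRep T.2 S.2 Φ)) ∧
    -- the involutive case
    (∀ [StarRing A] [StarModule 𝕜 A] (hD : D.IsInvolutive), R.IsInvolutive →
      (∀ ρ ∈ R.covRepSet μ 𝓧, ρ.2.IsInvolutive →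
        IsInvolutiveRep (R.cpStar μ hD) (R.integration μ ρ).2) ∧
      (∀ T ∈ R.repSet μ 𝓧, IsInvolutiveRep (R.cpStar μ hD) T.2 →
        (R.separatedRep μ T.2).IsInvolutive)) :=
  theoremt_general μ D hA R 𝓧
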